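/- **Markoff triples and matrices.** Consider the rooted tree of triples $\mathbf m=(m,m_1,m_2)$ of positive integers (solutions of $m^2+m_1^2+m_2^2=3mm_1m_2$) with root $(2,1,1)$, whose only successor, on the left, is $(5,1,2)$, and in which every node $(m,m_1,m_2)\ne(2,1,1)$ has a left successor $(3mm_1-m_2,\,m_1,\,m)$ and a right successor $(3mm_2-m_1,\,m,\,m_2)$. Let $\Sigma^*$ be the set of all its nodes; each triple occurs at exactly one node. Put $M=\begin{pmatrix}3&1\\-1&0\end{pmatrix}$. Attach to $(5,1,2)$ the triple of matrices $$\left(\begin{pmatrix}5&3\\3&2\end{pmatrix},\ \begin{pmatrix}1&1\\1&2\end{pmatrix},\ \begin{pmatrix}2&1\\1&1\end{pmatrix}\right),$$ and, when $(\mathbf x,\mathbf x_1,\mathbf x_2)$ is attached to a node, attach $(\mathbf x_1M\mathbf x,\ \mathbf x_1,\ \mathbf x)$ to its left and $(\mathbf xM\mathbf x_2,\ \mathbf x,\ \mathbf x_2)$ to its right successor. For $\mathbf m\in\Sigma^*$, $\mathbf m\neq(2,1,1)$, let $\mathbf x_{\mathbf m}$ be the first component of the triple attached to $\mathbf m$,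 and let $\mathbf x_{(2,1,1)}=\begin{pmatrix}2&1\\1&1\end{pmatrix}$. **Zigzags.** A zigzag is a sequence $\mathbf m^{(1)},\mathbf m^{(2)},\dots$ of nodes such that, for each $i\ge1$, $\mathbf m^{(i+1)}$ is a successor of $\mathbf m^{(i)}$ on some side and $\mathbf m^{(i+2)}$ is a successor of $\mathbf m^{(i+1)}$ on the other side; it is maximal if it cannot be extended by inserting an ancestor of $\mathbf m^{(1)}$ as a new first element. Each $\mathbf m\in\Sigma^*$ is the first element of a unique maximal zigzag. **Extremal numbers.** Let $\gamma=(1+\sqrt5)/2$. An irrational, non-quadratic real number $\xi$ is extremal if there is a constant $c>0$ such that, for every real $X\ge1$, the inequalities $|x_0|\le X$, $|x_0\xi-x_1|\le cX^{-1/\gamma}$, $|x_0\xi^2-x_2|\le cX^{-1/\gamma}$ have a non-zero solution $(x_0,x_1,x_2)\in\mathbb Z^3$. Writing $\|\cdot\|$ for the largest absolute value of the coefficients of a matrix or row vector, we say that a sequence $(\mathbf x_i)_{i\ge1}$ of symmetric $2\times2$ matrices, each with relatively prime integer coefficients, corresponds to $\xi$ if it is unbounded and $$\|\mathbf x_{i+1}\|\asymp\|\mathbf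 x_i\|^{\gamma},\qquad \|(\xi,-1)\mathbf x_i\|\asymp\|\mathbf x_i\|^{-1},\qquad |\det\mathbf x_i|\asymp1,$$ with implied constants independent of $i$. **Minima.** For $\xi\in\mathbb R$, the Lagrange constant $\nu(\xi)$ is the infimum of all $c>0$ such that $|\xi-p/q|\le c/q^2$ has infinitely many solutions $(p,q)\in\mathbb Z^2$ with $q\ge1$. For a real binary quadratic form $F$, put $\mu(F)=\inf\{|F(x,y)|\,;\,(x,y)\in\mathbb Z^2,\ (x,y)\ne(0,0)\}$. **Corollary.** Let $\mathbf m\in\Sigma^*$, and let $\mathbf m=\mathbf m^{(1)},\mathbf m^{(2)},\dots$ be the maximal zigzag originating from $\mathbf m$. There is exactly one extremal number $\xi_{\mathbf m}$ to which the sequence $(\mathbf x_{\mathbf m^{(i)}})_{i\ge1}$ corresponds, and, with $G_{\mathbf m}(U,T)=(T-\xi_{\mathbf m}U)\,(T-(\xi_{\mathbf m}+3)U)$, $$\nu(\xi_{\mathbf m})=\frac{\mu(G_{\mathbf m})}{3}=\frac13 .$$ -/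

import Mathlib

namespace MarkoffExtremal

/-! ### The tree of Markoff triples -/

/-- The two sides of a binary tree. -/
inductive Side : Type
  | left
  | right

/-- The opposite side. -/
def Side.other : Side → Side
  | .left => .right
  | .right => .left

/-- The vertices of a full rooted binary tree: the root `base`, and the left and the right
successor of every vertex. -/
inductive BinTree : Type
  | base
  | left (v : BinTree)
  | right (v : BinTree)

/-- The Markoff triple `(m, m₁, m₂)` at a vertex of the tree with root `(5, 1, 2)`; the successors of
`(m, m₁, m₂)` are `(3 m m₁ - m₂, m₁, m)` on the left and `(3 m m₂ - m₁, m, m₂)` on the right. -/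
def BinTree.triple : BinTree → ℤ × ℤ × ℤ
  | .base => (5, 1, 2)
  | .left v => match v.triple with
    | (m, m₁, m₂) => (3 * m * m₁ - m₂, m₁, m)
  | .right v => match v.triple with
    | (m, m₁, m₂) => (3 * m * m₂ - m₁, m, m₂)

/-- The matrix `M` with rows `(3, 1)` and `(-1, 0)`. -/
def M : Matrix (Fin 2) (Fin 2) ℤ := !![3, 1; -1, 0]

/-- The triple of matrices `(x, x₁, x₂)` at a vertex of the lifted tree; the successors of
`(x, x₁, x₂)` are `(x₁ M x, x₁, x)` on the left and `(x M x₂, x, x₂)` on the right. -/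
def BinTree.matrices : BinTree →
    Matrix (Fin 2) (Fin 2) ℤ × Matrix (Fin 2) (Fin 2) ℤ × Matrix (Fin 2) (Fin 2) ℤ
  | .base => (!![5, 3; 3, 2], !![1, 1; 1, 2], !![2, 1; 1, 1])
  | .left v => match v.matrices with
    | (x, x₁, _) => (x₁ * M * x, x₁, x)
  | .right v => match v.matrices with
    | (x, _, x₂) => (x * M * x₂, x, x₂)

/-- The vertices of the extended tree: a new root `root`, carrying `(2, 1, 1)`, whose only successor,
on the left, is the root of the previous tree. -/
inductive Vertex : Type
  | root
  | node (v : BinTree)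

/-- The Markoff triple at a vertex of the extended tree. -/
def Vertex.triple : Vertex → ℤ × ℤ × ℤ
  | .root => (2, 1, 1)
  | .node v => v.triple

/-- The symmetric matrix `x_m` attached to a vertex of the extended tree. -/
def Vertex.matrix : Vertex → Matrix (Fin 2) (Fin 2) ℤ
  | .root => !![2, 1; 1, 1]
  | .node v => v.matrices.1

/-- The set `Σ*` of Markoff triples occurring in the extended tree. -/
def SigmaStar : Set (ℤ × ℤ × ℤ) := Set.range Vertex.triple

theorem BinTree.triple_bounds (v : BinTree) :
    1 ≤ v.triple.2.1 ∧ 1 ≤ v.triple.2.2 ∧ v.triple.2.1 < v.triple.1 ∧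
      v.triple.2.2 < v.triple.1 ∧ 5 ≤ v.triple.1 := by
  induction v with
  | base => simp [BinTree.triple]
  | left v ih =>
    simp only [BinTree.triple]
    refine ⟨?_, ?_, ?_, ?_, ?_⟩ <;> nlinarith [ih.1, ih.2.1, ih.2.2.1, ih.2.2.2.1, ih.2.2.2.2]
  | right v ih =>
    simp only [BinTree.triple]
    refine ⟨?_, ?_, ?_, ?_, ?_⟩ <;> nlinarith [ih.1, ih.2.1, ih.2.2.1, ih.2.2.2.1, ih.2.2.2.2]

theorem BinTree.triple_injective : Function.Injective BinTree.triple := by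
  intro v
  induction v with
  | base =>
    intro w h
    cases w with
    | base => rfl
    | left w =>
      have := w.triple_bounds
      simp only [BinTree.triple, Prod.mk.injEq] at h
      omega
    | right w =>
      have := w.triple_bounds
      simp only [BinTree.triple, Prod.mk.injEq] at h
      omega
  | left v ih =>
    intro w h
    have hv := v.triple_bounds
    cases w with
    | base =>
      simp only [BinTree.triple, Prod.mk.injEq] at h
      omega
    | left w =>
      simp only [BinTree.triple, Prod.mk.injEq] at h
      obtain ⟨h1, h2, h3⟩ := h
      rw [h2, h3] at h1
      rw [ih (Prod.ext h3 (Prod.ext h2 (by linarith)))]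
    | right w =>
      have := w.triple_bounds
      have h2 : v.triple.2.1 = w.triple.1 := congrArg (fun t => t.2.1) h
      have h3 : v.triple.1 = w.triple.2.2 := congrArg (fun t => t.2.2) h
      omega
  | right v ih =>
    intro w h
    have hv := v.triple_bounds
    cases w with
    | base =>
      simp only [BinTree.triple, Prod.mk.injEq] at h
      omega
    | left w =>
      have := w.triple_bounds
      have h2 : v.triple.1 = w.triple.2.1 := congrArg (fun t => t.2.1) h
      have h3 : v.triple.2.2 = w.triple.1 := congrArg (fun t => t.2.2) h
      omega
    | right w =>
      simp only [BinTree.triple, Prod.mk.injEq] at h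
      obtain ⟨h1, h2, h3⟩ := h
      rw [h2, h3] at h1
      rw [ih (Prod.ext h2 (Prod.ext (by linarith) h3))]

/-- Every triple of `Σ*` occurs at exactly one vertex of the extended tree. -/
theorem Vertex.triple_injective : Function.Injective Vertex.triple := by
  intro v w h
  cases v with
  | root =>
    cases w with
    | root => rfl
    | node w =>
      have := w.triple_bounds
      simp only [Vertex.triple, Prod.ext_iff] at h
      omega
  | node v =>
    cases w with
    | root =>
      have := v.triple_bounds
      simp only [Vertex.triple, Prod.ext_iff] at h
      omega
    | node w => rw [BinTree.triple_injective h]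

/-- `IsSucc d v w`: the vertex `w` is the successor of `v` on the side `d`. -/
inductive IsSucc : Side → Vertex → Vertex → Prop
  | root : IsSucc .left .root (.node .base)
  | left (v : BinTree) : IsSucc .left (.node v) (.node v.left)
  | right (v : BinTree) : IsSucc .right (.node v) (.node v.right)

/-- A zigzag: each vertex is a successor of the preceding one on some side, and the next one is a
successor on the other side. -/
def IsZigzag (s : ℕ → Vertex) : Prop :=
  ∀ i, ∃ d : Side, IsSucc d (s i) (s (i + 1)) ∧ IsSucc d.other (s (i + 1)) (s (i + 2))

/-- The sequence `w, s 0, s 1, …`. -/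
def prepend (w : Vertex) (s : ℕ → Vertex) : ℕ → Vertex
  | 0 => w
  | i + 1 => s i

/-- A zigzag that cannot be extended by inserting an ancestor as a new first element. -/
def IsMaximalZigzag (s : ℕ → Vertex) : Prop :=
  IsZigzag s ∧ ∀ w, ¬ IsZigzag (prepend w s)

theorem IsSucc.unique {d : Side} {v w w' : Vertex} (h : IsSucc d v w) (h' : IsSucc d v w') :
    w = w' := by
  cases h <;> cases h' <;> rfl

theorem IsSucc.side_unique {d d' : Side} {v v' w : Vertex} (h : IsSucc d v w)
    (h' : IsSucc d' v' w) : d = d' := by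
  cases h <;> cases h' <;> rfl

theorem IsSucc.exists_next {v w : Vertex} {d : Side} (h : IsSucc d v w) (e : Side) :
    ∃ u, IsSucc e w u := by
  cases h <;> cases e
  · exact ⟨_, .left _⟩
  · exact ⟨_, .right _⟩
  · exact ⟨_, .left _⟩
  · exact ⟨_, .right _⟩
  · exact ⟨_, .left _⟩
  · exact ⟨_, .right _⟩

theorem IsZigzag.prepend_iff {s : ℕ → Vertex} (hs : IsZigzag s) (w : Vertex) :
    IsZigzag (prepend w s) ↔ ∃ d, IsSucc d w (s 0) ∧ IsSucc d.other (s 0) (s 1) := by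
  refine ⟨fun h => h 0, fun h i => ?_⟩
  cases i with
  | zero => exact h
  | succ i => exact hs i

/-- Every vertex of the extended tree is the first element of exactly one maximal zigzag. -/
theorem existsUnique_maximalZigzag (v : Vertex) :
    ∃! s : ℕ → Vertex, IsMaximalZigzag s ∧ s 0 = v := by
  -- the side on which the zigzag starts
  have key : ∃ e : Side, (∃ w, IsSucc e v w) ∧ (∀ d w u, IsSucc d w v → IsSucc d.other v u → d ≠ e.other) ∧
      ∀ d, d ≠ e → (∀ u, ¬ IsSucc d v u) ∨ ∃ w, IsSucc d.other w v := by
    match v with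
    | .root => 
      refine ⟨.left, ⟨_, .root⟩, ?_, ?_⟩
      · intro d w u h; cases h
      · intro d hd; left; intro u hu; cases hu; exact hd rfl
    | .node .base =>
      refine ⟨.left, ⟨_, .left _⟩, ?_, ?_⟩
      · intro d w u h _; cases h; simp [Side.other]
      · intro d hd; cases d; exact absurd rfl hd; exact .inr ⟨_, .root⟩
    | .node (.left v) =>
      refine ⟨.left, ⟨_, .left _⟩, ?_, ?_⟩
      · intro d w u h _; cases h; simp [Side.other]
      · intro d hd; cases d; exact absurd rfl hd; exact .inr ⟨_, .left _⟩
    | .node (.right v) =>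
      refine ⟨.right, ⟨_, .right _⟩, ?_, ?_⟩
      · intro d w u h _; cases h; simp [Side.other]
      · intro d hd; cases d; exact .inr ⟨_, .right _⟩; exact absurd rfl hd
  have oo : ∀ d : Side, d.other.other = d := by intro d; cases d <;> rfl
  obtain ⟨e, ⟨w₁, hw₁⟩, h2, h3⟩ := key
  -- existence: iterate on pairs (current vertex, next side), starting at (v, e)
  let T := {p : Vertex × Side // ∃ w, IsSucc p.2 p.1 w}
  have step : ∀ p : T, ∃ q : T, IsSucc p.1.2 p.1.1 q.1.1 ∧ q.1.2 = p.1.2.other := by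
    rintro ⟨⟨a, d⟩, w, hw⟩
    exact ⟨⟨(w, d.other), hw.exists_next _⟩, hw, rfl⟩
  choose f hf hf' using step
  let t : ℕ → T := fun n => f^[n] ⟨(v, e), w₁, hw₁⟩
  have ht : ∀ i, t (i + 1) = f (t i) := fun i => Function.iterate_succ_apply' f i _
  have hz : IsZigzag (fun i => (t i).1.1) := by
    intro i
    refine ⟨(t i).1.2, ?_, ?_⟩
    · show IsSucc _ _ (t (i+1)).1.1
      rw [ht]; exact hf _
    · show IsSucc _ (t (i+1)).1.1 (t (i+1+1)).1.1
      rw [ht (i+1), ← hf' (t i), ← ht]; exact hf _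
  refine ⟨fun i => (t i).1.1, ⟨⟨hz, ?_⟩, rfl⟩, ?_⟩
  · intro w hw
    rw [hz.prepend_iff] at hw
    obtain ⟨d, hd, hd'⟩ := hw
    have h0 : IsSucc e v (t 1).1.1 := by
      have := hf (t 0); rw [← ht] at this; exact this
    refine h2 d w _ hd hd' ?_
    have hd'' : IsSucc d.other v (t 1).1.1 := hd'
    have := h0.side_unique hd''
    rw [this, oo]
  · rintro s ⟨⟨hs, hm⟩, hs0⟩
    have hstart : IsSucc e (s 0) (s 1) := by
      obtain ⟨d, hd, -⟩ := hs 0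
      by_cases hde : d = e
      · exact hde ▸ hd
      · rcases h3 d hde with h | ⟨w, h⟩
        · exact absurd (hs0 ▸ hd) (h _)
        · exact absurd ((hs.prepend_iff w).2 ⟨d.other, hs0 ▸ h, by rw [oo]; exact hd⟩) (hm w)
    have claim : ∀ i, s i = (t i).1.1 ∧ IsSucc (t i).1.2 (s i) (s (i + 1)) := by
      intro i
      induction i with
      | zero => exact ⟨hs0, hstart⟩
      | succ i ih =>
        have h1 : IsSucc (t i).1.2 (s i) (t (i + 1)).1.1 := by rw [ih.1, ht]; exact hf _
        refine ⟨ih.2.unique h1, ?_⟩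
        obtain ⟨d, hd, hd'⟩ := hs i
        rw [ht, hf', ih.2.side_unique hd]
        exact hd'
    exact funext fun i => (claim i).1

/-! ### Extremal numbers -/

/-- Extremal numbers: irrational, non-quadratic real numbers `ξ` such that, for some constant `c`, the
system `|x₀| ≤ X`, `|x₀ ξ - x₁| ≤ c X^(-1/γ)`, `|x₀ ξ² - x₂| ≤ c X^(-1/γ)` has a non-zero solution
in integers for every real `X ≥ 1`, where `γ` is the golden ratio. -/
def IsExtremal (ξ : ℝ) : Prop :=
  Irrational ξ ∧
  (∀ a b c : ℤ, a ≠ 0 → (a : ℝ) * ξ ^ 2 + b * ξ + c ≠ 0) ∧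
  ∃ c : ℝ, 0 < c ∧ ∀ X : ℝ, 1 ≤ X → ∃ x₀ x₁ x₂ : ℤ,
    (x₀, x₁, x₂) ≠ (0, 0, 0) ∧
    |(x₀ : ℝ)| ≤ X ∧
    |(x₀ : ℝ) * ξ - x₁| ≤ c * X ^ (-1 / Real.goldenRatio) ∧
    |(x₀ : ℝ) * ξ ^ 2 - x₂| ≤ c * X ^ (-1 / Real.goldenRatio)

/-- The largest absolute value of the coefficients of a matrix. -/
def matNorm (A : Matrix (Fin 2) (Fin 2) ℤ) : ℝ :=
  max (max |(A 0 0 : ℝ)| |(A 0 1 : ℝ)|) (max |(A 1 0 : ℝ)| |(A 1 1 : ℝ)|)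

/-- The largest absolute value of the coefficients of the row vector `(ξ, -1) A`. -/
def rowNorm (ξ : ℝ) (A : Matrix (Fin 2) (Fin 2) ℤ) : ℝ :=
  max |ξ * (A 0 0 : ℝ) - (A 1 0 : ℝ)| |ξ * (A 0 1 : ℝ) - (A 1 1 : ℝ)|

/-- The relation `f ≍ g` between sequences of non-negative real numbers, with constants that do not
depend on the index. -/
def Comparable (f g : ℕ → ℝ) : Prop :=
  ∃ c C : ℝ, 0 < c ∧ 0 < C ∧ ∀ i, c * g i ≤ f i ∧ f i ≤ C * g i

/-- `Corresponds ξ x`: `x` is an unbounded sequence of symmetric matrices with relatively prime integer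
coefficients such that `‖x_{i+1}‖ ≍ ‖x_i‖^γ`, `‖(ξ, -1) x_i‖ ≍ ‖x_i‖⁻¹` and `|det x_i| ≍ 1`. -/
structure Corresponds (ξ : ℝ) (x : ℕ → Matrix (Fin 2) (Fin 2) ℤ) : Prop where
  symm : ∀ i, (x i).IsSymm
  primitive : ∀ i, ∀ d : ℤ, (∀ j k, d ∣ x i j k) → IsUnit d
  unbounded : ∀ B : ℝ, ∃ i, B < matNorm (x i)
  growth : Comparable (fun i => matNorm (x (i + 1))) (fun i => matNorm (x i) ^ Real.goldenRatio)
  approx : Comparable (fun i => rowNorm ξ (x i)) (fun i => (matNorm (x i))⁻¹)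
  det : Comparable (fun i => |((x i).det : ℝ)|) (fun _ => 1)

/-- `IsXi m ξ`: the number `ξ` is the extremal number `ξ_m`, that is, an extremal number to which
corresponds the sequence of matrices attached to the maximal zigzag originating from `m`. -/
def IsXi (m : ℤ × ℤ × ℤ) (ξ : ℝ) : Prop :=
  IsExtremal ξ ∧ ∃ s : ℕ → Vertex, IsMaximalZigzag s ∧ (s 0).triple = m ∧
    Corresponds ξ (fun i => (s i).matrix)

/-! ### The Lagrange constant and the minimum of a binary form -/

/-- The Lagrange constant `ν(ξ)`: the infimum of all `c > 0` for which `|ξ - p/q| ≤ c/q²` has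
infinitely many solutions `(p, q) ∈ ℤ²` with `q ≥ 1`. -/
noncomputable def lagrangeConstant (ξ : ℝ) : ℝ :=
  sInf {c : ℝ | 0 < c ∧
    {pq : ℤ × ℤ | 1 ≤ pq.2 ∧ |ξ - (pq.1 : ℝ) / (pq.2 : ℝ)| ≤ c / (pq.2 : ℝ) ^ 2}.Infinite}

/-- `μ(F)`: the infimum of `|F(x, y)|` over all `(x, y) ∈ ℤ²` with `(x, y) ≠ (0, 0)`. -/
noncomputable def formMin (F : ℝ → ℝ → ℝ) : ℝ :=
  sInf {r : ℝ | ∃ x y : ℤ, (x, y) ≠ (0, 0) ∧ r = |F x y|}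

/-- The form `(T - ξ U) (T - (ξ + 3) U)`; it is `G_m(U, T)` when `ξ = ξ_m`. -/
def G (ξ : ℝ) : ℝ → ℝ → ℝ := fun U T => (T - ξ * U) * (T - (ξ + 3) * U)

end MarkoffExtremal

/-!
Write `m, k, l` for the entries of a symmetric matrix `x` of the tree, and let `F(U, T) = m T² -
(2k + 3m) U T + (l + 3k) U²` be its Markoff form, of discriminant `9m² - 4`. Along a zigzag, each
matrix is a product of the two preceding ones and of `M` or its transpose, in alternating order.
Hence the upper left entries satisfy the Markoff equation, `m_{i+2}` is comparable to `m_{i+1}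
m_i`, and `k_{i+1} / m_{i+1} - k_{i+2} / m_{i+2}` is `± m_i / (m_{i+1} m_{i+2})` with alternating
signs. The quotients `k_i / m_i` therefore converge to a number `ξ`, and `m_i |m_i ξ - k_i|` tends
to `1/3` (`IsMarkoffChain.tendsto_corner_mul_abs`). This yields that `ξ` is extremal and
corresponds to the sequence (`IsMarkoffChain.isExtremal`, `IsMarkoffChain.corresponds`), that it
is the only such number, and that `ν(ξ) ≤ 1/3`. It is not quadratic, since for a quadratic
polynomial `h` with integer coefficients that vanishes at `ξ` the numbers `m_i² h(k_i / m_i)`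
would be equal to minus its leading coefficient for large `i`, while `k_i / m_i - ξ` changes sign
at each step.

The forms `F / m` tend to `G`, so the lower bound `|G| ≥ 1` on non-zero integer points follows
from Markoff's theorem that `|F| ≥ m` there. It is proved here by a descent
(`IsMarkoffEdge.le_quadForm`) through the ideal triangulation of a punctured torus given by the
Markoff triple `(m, m₁, m₂)`: if `F ≥ m` at the ends of an edge, and if its polarization there is
at least `3m` times the length of the edge, then the Markoff equation propagates these
inequalities to the next triangle, so to the cone spanned by the edge. Three edges, one for `-F`
and two for `F`, are enough to reach a given integer point when `i` is large
(`IsMarkoffChain.eventually_corner_le`). Finally `|G| ≥ 1` gives `ν(ξ) ≥ 1/3`, because `G(q, p) =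
(p - ξ q) (p - ξ q - 3q)`.
-/

open Filter Topology Matrix

namespace MarkoffExtremal

/-! ### Binary quadratic forms over a Markoff triangulation -/

/-- The determinant of two integer vectors. -/
def cross (p q : ℤ × ℤ) : ℤ := p.1 * q.2 - p.2 * q.1

/-- The binary quadratic form with coefficients `A, B, C`. -/
def quadForm (A B C : ℤ) (v : ℤ × ℤ) : ℤ := A * v.1 ^ 2 + B * v.1 * v.2 + C * v.2 ^ 2

/-- The polarization `F (p + q) - F p - F q` of the form `F` with coefficients `A, B, C`. -/
def polarForm (A B C : ℤ) (p q : ℤ × ℤ) : ℤ :=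
  2 * A * p.1 * q.1 + B * (p.1 * q.2 + p.2 * q.1) + 2 * C * p.2 * q.2

/-- An edge `p q` of an ideal triangulation of Markoff type, on one side of which the form `F`
with coefficients `A, B, C` is to be bounded below by `μ`. The side lengths (determinants) of its
triangles are `a, b, c`, the edge itself having length `a`. The integer vector `r = (c p + b q) /
a` is the third vertex of the triangle in the cone spanned by `p` and `q`, and `s = (c q - b p) /
a` is, up to sign, the third vertex of the triangle on the other side; the existence of `s` makes
the adjacent triangles integral. The last three fields say that `F` is large on the edge. -/
structure IsMarkoffEdge (A B C μ a b c : ℤ) (p q r s : ℤ × ℤ) : Prop where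
  a_pos : 0 < a
  b_pos : 0 < b
  c_pos : 0 < c
  markoff : a ^ 2 + b ^ 2 + c ^ 2 = 3 * a * b * c
  coprime_ab : IsCoprime a b
  coprime_bc : IsCoprime b c
  coprime_ca : IsCoprime c a
  cross_eq : cross p q = a
  r_fst : a * r.1 = c * p.1 + b * q.1
  r_snd : a * r.2 = c * p.2 + b * q.2
  s_fst : a * s.1 = c * q.1 - b * p.1
  s_snd : a * s.2 = c * q.2 - b * p.2
  coprime_p : IsCoprime p.1 p.2
  coprime_q : IsCoprime q.1 q.2
  le_p : μ ≤ quadForm A B C p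
  le_q : μ ≤ quadForm A B C q
  le_polar : 3 * μ * a ≤ polarForm A B C p q

namespace IsMarkoffEdge

variable {A B C μ a b c : ℤ} {p q r s : ℤ × ℤ}

theorem cross_left (h : IsMarkoffEdge A B C μ a b c p q r s) : cross p r = b := by
  refine mul_left_cancel₀ h.a_pos.ne' ?_
  have := h.cross_eq
  unfold cross at *
  linear_combination p.1 * h.r_snd - p.2 * h.r_fst + b * this

theorem cross_right (h : IsMarkoffEdge A B C μ a b c p q r s) : cross r q = c := by
  refine mul_left_cancel₀ h.a_pos.ne' ?_
  have := h.cross_eq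
  unfold cross at *
  linear_combination q.2 * h.r_fst - q.1 * h.r_snd + c * this

theorem coprime_r (h : IsMarkoffEdge A B C μ a b c p q r s) : IsCoprime r.1 r.2 := by
  obtain ⟨u, w, huw⟩ := h.coprime_bc
  have h1 := h.cross_left
  have h2 := h.cross_right
  unfold cross at h1 h2
  exact ⟨-u * p.2 + w * q.2, u * p.1 - w * q.1, by linear_combination u * h1 + w * h2 + huw⟩

/-- The bound at the new vertex: `a² F(r) = c² F(p) + b c B(p, q) + b² F(q)` is at least
`μ (b² + c² + 3 a b c)`, and the Markoff equation makes this at least `μ a²`. -/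
theorem le_r (h : IsMarkoffEdge A B C μ a b c p q r s) (hμ : 0 ≤ μ) :
    μ ≤ quadForm A B C r := by
  have e : a ^ 2 * quadForm A B C r
      = c ^ 2 * quadForm A B C p + b * c * polarForm A B C p q + b ^ 2 * quadForm A B C q := by
    have : a ^ 2 * quadForm A B C r
        = A * (a * r.1) ^ 2 + B * (a * r.1) * (a * r.2) + C * (a * r.2) ^ 2 := by
      unfold quadForm; ring
    rw [this, h.r_fst, h.r_snd]
    unfold quadForm polarForm
    ring
  have h1 := mul_le_mul_of_nonneg_left h.le_p (sq_nonneg c)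
  have h2 := mul_le_mul_of_nonneg_left h.le_q (sq_nonneg b)
  have h3 := mul_le_mul_of_nonneg_left h.le_polar (mul_pos h.b_pos h.c_pos).le
  have h4 : 0 ≤ μ * (b ^ 2 + c ^ 2) := by positivity
  have h5 : μ * (a ^ 2 + b ^ 2 + c ^ 2) = μ * (3 * a * b * c) := by rw [h.markoff]
  refine le_of_mul_le_mul_left (a := a ^ 2) ?_ (pow_pos h.a_pos 2)
  rw [e]
  linarith

/-- The edge `p r` of the triangle `p r q`, seen from `q`, is again of Markoff type. -/
theorem left (h : IsMarkoffEdge A B C μ a b c p q r s) (hμ : 0 ≤ μ) :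
    IsMarkoffEdge A B C μ b c a p r (3 * c * p.1 + s.1, 3 * c * p.2 + s.2) q where
  a_pos := h.b_pos
  b_pos := h.c_pos
  c_pos := h.a_pos
  markoff := by linear_combination h.markoff
  coprime_ab := h.coprime_bc
  coprime_bc := h.coprime_ca
  coprime_ca := h.coprime_ab
  cross_eq := h.cross_left
  r_fst := mul_left_cancel₀ h.a_pos.ne' <| by
    linear_combination b * h.s_fst - c * h.r_fst - p.1 * h.markoff
  r_snd := mul_left_cancel₀ h.a_pos.ne' <| by
    linear_combination b * h.s_snd - c * h.r_snd - p.2 * h.markoff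
  s_fst := by linear_combination -h.r_fst
  s_snd := by linear_combination -h.r_snd
  coprime_p := h.coprime_p
  coprime_q := h.coprime_r
  le_p := h.le_p
  le_q := h.le_r hμ
  le_polar := by
    have e : a * polarForm A B C p r = 2 * c * quadForm A B C p + b * polarForm A B C p q := by
      unfold quadForm polarForm
      linear_combination (2 * A * p.1 + B * p.2) * h.r_fst + (B * p.1 + 2 * C * p.2) * h.r_snd
    have h1 := mul_le_mul_of_nonneg_left (hμ.trans h.le_p) (by linarith [h.c_pos] : 0 ≤ 2 * c)
    have h2 := mul_le_mul_of_nonneg_left h.le_polar h.b_pos.le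
    refine le_of_mul_le_mul_left (a := a) ?_ h.a_pos
    rw [e]
    linarith

/-- The edge `r q` of the triangle `p r q`, seen from `p`, is again of Markoff type. -/
theorem right (h : IsMarkoffEdge A B C μ a b c p q r s) (hμ : 0 ≤ μ) :
    IsMarkoffEdge A B C μ c a b r q (3 * b * q.1 - s.1, 3 * b * q.2 - s.2) (-p.1, -p.2) where
  a_pos := h.c_pos
  b_pos := h.a_pos
  c_pos := h.b_pos
  markoff := by linear_combination h.markoff
  coprime_ab := h.coprime_ca
  coprime_bc := h.coprime_ab
  coprime_ca := h.coprime_bc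
  cross_eq := h.cross_right
  r_fst := mul_left_cancel₀ h.a_pos.ne' <| by
    linear_combination -c * h.s_fst - b * h.r_fst - q.1 * h.markoff
  r_snd := mul_left_cancel₀ h.a_pos.ne' <| by
    linear_combination -c * h.s_snd - b * h.r_snd - q.2 * h.markoff
  s_fst := by linear_combination h.r_fst
  s_snd := by linear_combination h.r_snd
  coprime_p := h.coprime_r
  coprime_q := h.coprime_q
  le_p := h.le_r hμ
  le_q := h.le_q
  le_polar := by
    have e : a * polarForm A B C r q = c * polarForm A B C p q + 2 * b * quadForm A B C q := by
      unfold quadForm polarForm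
      linear_combination (2 * A * q.1 + B * q.2) * h.r_fst + (B * q.1 + 2 * C * q.2) * h.r_snd
    have h1 := mul_le_mul_of_nonneg_left (hμ.trans h.le_q) (by linarith [h.b_pos] : 0 ≤ 2 * b)
    have h2 := mul_le_mul_of_nonneg_left h.le_polar h.c_pos.le
    refine le_of_mul_le_mul_left (a := a) ?_ h.a_pos
    rw [e]
    linarith

end IsMarkoffEdge

theorem le_quadForm_of_cross_eq_zero {A B C μ : ℤ} {p v : ℤ × ℤ} (hμ : 0 ≤ μ)
    (hp : IsCoprime p.1 p.2) (hle : μ ≤ quadForm A B C p) (hv : v ≠ 0) (h : cross p v = 0) :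
    μ ≤ quadForm A B C v := by
  obtain ⟨u, w, huw⟩ := hp
  unfold cross at h
  have h1 : v.1 = (u * v.1 + w * v.2) * p.1 := by linear_combination -w * h - v.1 * huw
  have h2 : v.2 = (u * v.1 + w * v.2) * p.2 := by linear_combination u * h - v.2 * huw
  set t := u * v.1 + w * v.2
  have ht : t ≠ 0 := by
    intro ht
    rw [ht, zero_mul] at h1 h2
    exact hv (Prod.ext h1 h2)
  have e : quadForm A B C v = t ^ 2 * quadForm A B C p := by
    unfold quadForm; rw [h1, h2]; ring
  have : 1 ≤ t ^ 2 := by have := sq_pos_of_ne_zero ht; omega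
  rw [e]
  nlinarith

/-- A form that is large on a Markoff edge is large on the whole cone which the edge spans: descend
through the triangles towards `v`. With `n` an upper bound for `det(p, v) det(v, q) b c`, which is
`a b c` times the quotient `det(p, v) det(v, q) / a`, the descent terminates, since that quotient
decreases at each step while `a b c` is fixed. -/
theorem IsMarkoffEdge.le_quadForm {A B C μ a b c : ℤ} {p q r s v : ℤ × ℤ}
    (h : IsMarkoffEdge A B C μ a b c p q r s) (hμ : 0 ≤ μ) (hv : v ≠ 0)
    (hpv : 0 ≤ cross p v) (hvq : 0 ≤ cross v q) : μ ≤ quadForm A B C v := by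
  obtain ⟨n, hn⟩ : ∃ n : ℕ, cross p v * cross v q * (b * c) < n := by
    obtain ⟨n, hn⟩ := exists_nat_gt (cross p v * cross v q * (b * c))
    exact ⟨n, hn⟩
  induction n generalizing a b c p q r s with
  | zero =>
    have := mul_nonneg (mul_nonneg hpv hvq) (mul_pos h.b_pos h.c_pos).le
    simp at hn
    omega
  | succ n ih =>
    rcases hpv.eq_or_lt with hx | hx
    · exact le_quadForm_of_cross_eq_zero hμ h.coprime_p h.le_p hv hx.symm
    rcases hvq.eq_or_lt with hy | hy
    · refine le_quadForm_of_cross_eq_zero hμ h.coprime_q h.le_q hv ?_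
      unfold cross at hy ⊢
      linarith
    have e : a * cross v r = b * cross v q - c * cross p v := by
      unfold cross
      linear_combination v.1 * h.r_snd - v.2 * h.r_fst
    have ha := h.a_pos
    have hb := h.b_pos
    have hc := h.c_pos
    push_cast at hn
    rcases le_total 0 (cross v r) with hr | hr
    · refine ih (h.left hμ) hpv hr ?_
      have : 0 < (c * cross p v) ^ 2 := by positivity
      have e' : cross p v * cross v r * (c * a)
          = cross p v * cross v q * (b * c) - (c * cross p v) ^ 2 := by
        linear_combination c * cross p v * e
      omega
    · have hr' : cross r v = - cross v r := by unfold cross; ring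
      refine ih (h.right hμ) (by rw [hr']; omega) hvq ?_
      have : 0 < (b * cross v q) ^ 2 := by positivity
      have e' : cross r v * cross v q * (a * b)
          = cross p v * cross v q * (b * c) - (b * cross v q) ^ 2 := by
        rw [hr']
        linear_combination -b * cross v q * e
      omega

/-! ### Markoff triples of matrices -/

/-- The Markoff form `m T² - (2k + 3m) U T + (l + 3k) U²` attached to the symmetric matrix with
entries `m, k, l`, evaluated at `v = (U, T)`. -/
def markoffForm (x : Matrix (Fin 2) (Fin 2) ℤ) (v : ℤ × ℤ) : ℤ :=
  quadForm (x 1 1 + 3 * x 0 1) (-(2 * x 0 1 + 3 * x 0 0)) (x 0 0) v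

theorem isCoprime_add_mul {m k l : ℤ} (h : m * l - k ^ 2 = 1) (t : ℤ) :
    IsCoprime m (k + t * m) :=
  ⟨l + t * k, -k, by linear_combination h⟩

/-- The properties of the triple of matrices at a vertex of the tree, with `x` its first component:
the matrices are symmetric of determinant `1`, with `x = x₁ M x₂`, and their upper left entries
are positive, pairwise coprime, the largest one being that of `x`. -/
structure IsMarkoffNode (x x₁ x₂ : Matrix (Fin 2) (Fin 2) ℤ) : Prop where
  symm : x.IsSymm
  symm₁ : x₁.IsSymm
  symm₂ : x₂.IsSymm
  det : x.det = 1
  det₁ : x₁.det = 1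
  det₂ : x₂.det = 1
  prod : x = x₁ * M * x₂
  one_le₁ : 1 ≤ x₁ 0 0
  one_le₂ : 1 ≤ x₂ 0 0
  lt₁ : x₁ 0 0 < x 0 0
  lt₂ : x₂ 0 0 < x 0 0
  two_mul_le : 2 * x₁ 0 0 * x₂ 0 0 ≤ x 0 0
  coprime : IsCoprime (x₁ 0 0) (x₂ 0 0)
  coprime₁ : IsCoprime (x 0 0) (x₁ 0 0)
  coprime₂ : IsCoprime (x 0 0) (x₂ 0 0)

theorem det_M : M.det = 1 := by simp [M, Matrix.det_fin_two]

theorem entries_mul_M_mul (y z : Matrix (Fin 2) (Fin 2) ℤ) (i j : Fin 2) :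
    (y * M * z) i j = (3 * y i 0 - y i 1) * z 0 j + y i 0 * z 1 j := by
  simp only [Matrix.mul_apply, Fin.sum_univ_two, M, Matrix.of_apply, Matrix.cons_val',
    Matrix.cons_val_zero, Matrix.cons_val_one, Matrix.cons_val_fin_one]
  ring

namespace IsMarkoffNode

variable {x x₁ x₂ : Matrix (Fin 2) (Fin 2) ℤ}

theorem cross₁ (h : IsMarkoffNode x x₁ x₂) :
    x 0 0 * x₁ 0 1 - x₁ 0 0 * x 0 1 = x₂ 0 0 := by
  have e1 := (congrFun (congrFun h.prod 0) 0).trans (entries_mul_M_mul _ _ _ _)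
  have e2 := (congrFun (congrFun h.prod 1) 0).trans (entries_mul_M_mul _ _ _ _)
  rw [h.symm.apply 0 1] at e2
  have d := h.det₁
  rw [Matrix.det_fin_two] at d
  rw [h.symm₁.apply 0 1] at *
  rw [e1, e2]
  linear_combination x₂ 0 0 * d

theorem cross₂ (h : IsMarkoffNode x x₁ x₂) :
    x₂ 0 0 * x 0 1 - x 0 0 * x₂ 0 1 = x₁ 0 0 := by
  have e1 := (congrFun (congrFun h.prod 0) 0).trans (entries_mul_M_mul _ _ _ _)
  have e2 := (congrFun (congrFun h.prod 0) 1).trans (entries_mul_M_mul _ _ _ _)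
  have d := h.det₂
  rw [Matrix.det_fin_two] at d
  rw [h.symm₂.apply 0 1] at *
  rw [e1, e2]
  linear_combination x₁ 0 0 * d

theorem corner_eq (h : IsMarkoffNode x x₁ x₂) :
    x 0 0 = 3 * x₁ 0 0 * x₂ 0 0 - x₁ 0 1 * x₂ 0 0 + x₁ 0 0 * x₂ 0 1 := by
  have e1 := (congrFun (congrFun h.prod 0) 0).trans (entries_mul_M_mul _ _ _ _)
  rw [h.symm₂.apply 0 1] at e1
  linear_combination e1

theorem markoff (h : IsMarkoffNode x x₁ x₂) :
    x 0 0 ^ 2 + x₁ 0 0 ^ 2 + x₂ 0 0 ^ 2 = 3 * x 0 0 * x₁ 0 0 * x₂ 0 0 := by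
  linear_combination x 0 0 * h.corner_eq - x₂ 0 0 * h.cross₁ - x₁ 0 0 * h.cross₂

theorem det_eq (h : IsMarkoffNode x x₁ x₂) : x 0 0 * x 1 1 - x 0 1 ^ 2 = 1 := by
  have := h.det
  rw [Matrix.det_fin_two, h.symm.apply 0 1] at this
  linear_combination this

theorem prod_transpose (h : IsMarkoffNode x x₁ x₂) : x₂ * Mᵀ * x₁ = x := by
  have := congrArg Matrix.transpose h.prod
  rw [h.symm.eq, Matrix.transpose_mul, Matrix.transpose_mul, h.symm₁.eq, h.symm₂.eq] at this
  rw [this, Matrix.mul_assoc]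

/-- With `x = x₁ M x₂ = x₂ Mᵀ x₁`, the product `x₁ M x = x₁ (M x₂ Mᵀ) x₁` is symmetric. -/
theorem left (h : IsMarkoffNode x x₁ x₂) : IsMarkoffNode (x₁ * M * x) x₁ x := by
  have c : (x₁ * M * x) 0 0 = 3 * x 0 0 * x₁ 0 0 - x₂ 0 0 := by
    rw [entries_mul_M_mul, h.symm.apply 0 1]
    linear_combination -h.cross₁
  have := h.one_le₁
  have := h.one_le₂
  have := h.lt₁
  have := h.lt₂
  refine ⟨?_, h.symm₁, h.symm, ?_, h.det₁, h.det, rfl, h.one_le₁, by omega, ?_, ?_, ?_,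
    h.coprime₁.symm, ?_, ?_⟩
  · have e : x₁ * M * x = x₁ * M * x₂ * Mᵀ * x₁ := by
      rw [← h.prod_transpose]
      simp only [Matrix.mul_assoc]
    rw [Matrix.IsSymm, Matrix.transpose_mul, Matrix.transpose_mul, h.symm₁.eq, h.symm.eq, e,
      ← h.prod, Matrix.mul_assoc]
  · rw [Matrix.det_mul, Matrix.det_mul, h.det₁, h.det, det_M]; rfl
  · rw [c]; nlinarith
  · rw [c]; nlinarith
  · rw [c]; nlinarith
  · rw [c, sub_eq_neg_add]
    exact IsCoprime.add_mul_right_left (h.coprime.symm.neg_left) _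
  · rw [c, sub_eq_neg_add, show 3 * x 0 0 * x₁ 0 0 = x 0 0 * (3 * x₁ 0 0) by ring]
    exact IsCoprime.add_mul_left_left (h.coprime₂.symm.neg_left) _

theorem right (h : IsMarkoffNode x x₁ x₂) : IsMarkoffNode (x * M * x₂) x x₂ := by
  have c : (x * M * x₂) 0 0 = 3 * x 0 0 * x₂ 0 0 - x₁ 0 0 := by
    rw [entries_mul_M_mul, h.symm₂.apply 0 1]
    linear_combination -h.cross₂
  have := h.one_le₁
  have := h.one_le₂
  have := h.lt₁
  have := h.lt₂
  refine ⟨?_, h.symm, h.symm₂, ?_, h.det, h.det₂, rfl, by omega, h.one_le₂, ?_, ?_, ?_,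
    h.coprime₂, ?_, ?_⟩
  · have e : x * M * x₂ = x₂ * Mᵀ * x₁ * M * x₂ := by rw [h.prod_transpose]
    rw [Matrix.IsSymm, Matrix.transpose_mul, Matrix.transpose_mul, h.symm₂.eq, h.symm.eq, e]
    conv_lhs => rw [h.prod]
    simp only [Matrix.mul_assoc]
  · rw [Matrix.det_mul, Matrix.det_mul, h.det₂, h.det, det_M]; rfl
  · rw [c]; nlinarith
  · rw [c]; nlinarith
  · rw [c]; nlinarith
  · rw [c, sub_eq_neg_add, show 3 * x 0 0 * x₂ 0 0 = x 0 0 * (3 * x₂ 0 0) by ring]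
    exact IsCoprime.add_mul_left_left (h.coprime₁.symm.neg_left) _
  · rw [c, sub_eq_neg_add]
    exact IsCoprime.add_mul_right_left (h.coprime.neg_left) _

/-- The form is at least `m` below the slope `k/m`: it takes the value `m` at the ends of the
edge from `(0, 1)` to `-(m, k)`, whose adjacent triangles have third vertices `-(m₂, k₂)`
and `-(m₁, k₁)`. -/
theorem le_of_slope_le (h : IsMarkoffNode x x₁ x₂) {U T : ℤ} (hU : 0 < U)
    (hT : x 0 0 * T ≤ x 0 1 * U) : x 0 0 ≤ markoffForm x (U, T) := by
  have hm : 0 < x 0 0 := by linarith [h.one_le₁, h.lt₁]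
  have E : IsMarkoffEdge (x 1 1 + 3 * x 0 1) (-(2 * x 0 1 + 3 * x 0 0)) (x 0 0) (x 0 0)
      (x 0 0) (x₂ 0 0) (x₁ 0 0) (0, 1) (-x 0 0, -x 0 1) (-x₂ 0 0, -x₂ 0 1)
      (-x₁ 0 0, -x₁ 0 1) := by
    have d := h.det_eq
    refine ⟨hm, h.one_le₂, h.one_le₁, by linear_combination h.markoff, h.coprime₂, h.coprime.symm,
      h.coprime₁.symm, by simp [cross], by simp; ring, ?_, by simp; ring, ?_,
      isCoprime_one_right, ?_, ?_, ?_, ?_⟩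
    · linear_combination h.cross₂
    · linear_combination -h.cross₁
    · simpa using (isCoprime_add_mul d 0).neg_neg
    · simp [quadForm]
    · refine le_of_eq ?_
      unfold quadForm
      linear_combination -x 0 0 * d
    · refine le_of_eq ?_
      unfold polarForm
      ring
  have := E.le_quadForm (v := (-U, -T)) hm.le (by simp; omega) (by simp [cross]; omega)
    (by simp [cross]; linarith)
  simpa [markoffForm, quadForm] using this

/-- The form is at least `m` above the slope `k/m + 3`: it takes the value `m` at the ends of the
edge from `(m, k + 3m)` to `(0, 1)`. -/
theorem le_of_le_slope (h : IsMarkoffNode x x₁ x₂) {U T : ℤ} (hU : 0 < U)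
    (hT : (x 0 1 + 3 * x 0 0) * U ≤ x 0 0 * T) : x 0 0 ≤ markoffForm x (U, T) := by
  have hm : 0 < x 0 0 := by linarith [h.one_le₁, h.lt₁]
  have E : IsMarkoffEdge (x 1 1 + 3 * x 0 1) (-(2 * x 0 1 + 3 * x 0 0)) (x 0 0) (x 0 0)
      (x 0 0) (x₂ 0 0) (x₁ 0 0) (x 0 0, x 0 1 + 3 * x 0 0) (0, 1) (x₁ 0 0, x₁ 0 1 + 3 * x₁ 0 0)
      (-x₂ 0 0, -x₂ 0 1 - 3 * x₂ 0 0) := by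
    have d := h.det_eq
    refine ⟨hm, h.one_le₂, h.one_le₁, by linear_combination h.markoff, h.coprime₂, h.coprime.symm,
      h.coprime₁.symm, by simp [cross], by simp; ring, ?_, by simp; ring, ?_, ?_,
      isCoprime_one_right, ?_, ?_, ?_⟩
    · linear_combination h.cross₁
    · linear_combination h.cross₂
    · exact isCoprime_add_mul d 3
    · refine le_of_eq ?_
      unfold quadForm
      linear_combination -x 0 0 * d
    · simp [quadForm]
    · refine le_of_eq ?_
      unfold polarForm
      ring
  have := E.le_quadForm (v := (U, T)) hm.le (by simp; omega) (by simp [cross]; linarith)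
    (by simp [cross]; omega)
  simpa [markoffForm] using this

/-- The form is at most `-m` between the slopes `k₁/m₁` and `k₂/m₂ + 3`: it takes the value `-m` at
the ends of the edge from `(m₁, k₁)` to `(m₂, k₂ + 3m₂)`, and `(0, 1)` is the third vertex of the
triangle on the other side. -/
theorem le_neg_of_slope_between (h : IsMarkoffNode x x₁ x₂) {U T : ℤ} (hU : 0 < U)
    (hT₁ : x₁ 0 1 * U ≤ x₁ 0 0 * T) (hT₂ : x₂ 0 0 * T ≤ (x₂ 0 1 + 3 * x₂ 0 0) * U) :
    x 0 0 ≤ -markoffForm x (U, T) := by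
  have hm : 0 < x 0 0 := by linarith [h.one_le₁, h.lt₁]
  have h1 : x₁ 0 0 * x₁ 1 1 - x₁ 0 1 ^ 2 = 1 := by
    have := h.det₁
    rw [Matrix.det_fin_two, h.symm₁.apply 0 1] at this
    linear_combination this
  have h2 : x₂ 0 0 * x₂ 1 1 - x₂ 0 1 ^ 2 = 1 := by
    have := h.det₂
    rw [Matrix.det_fin_two, h.symm₂.apply 0 1] at this
    linear_combination this
  have d := h.det_eq
  have c1 := h.cross₁
  have c2 := h.cross₂
  have mk := h.markoff
  have E : IsMarkoffEdge (-(x 1 1 + 3 * x 0 1)) (2 * x 0 1 + 3 * x 0 0) (-x 0 0) (x 0 0)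
      (x 0 0) (x₂ 0 0) (x₁ 0 0) (x₁ 0 0, x₁ 0 1) (x₂ 0 0, x₂ 0 1 + 3 * x₂ 0 0)
      (3 * x₁ 0 0 * x₂ 0 0 - x 0 0, 3 * x₂ 0 0 * x₁ 0 1 - x 0 1) (0, 1) := by
    refine ⟨hm, h.one_le₂, h.one_le₁, by linear_combination h.markoff, h.coprime₂, h.coprime.symm,
      h.coprime₁.symm, ?_, ?_, ?_, by simp; ring, ?_, ?_, ?_, ?_, ?_, ?_⟩
    · simp only [cross]; linear_combination -h.corner_eq
    · linear_combination -mk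
    · refine mul_left_cancel₀ hm.ne' ?_
      linear_combination (x 0 1) * (-1) * mk + (3 * x 0 0 * x₂ 0 0 - x₁ 0 0) * c1 + x₂ 0 0 * c2
    · linear_combination h.corner_eq
    · simpa using isCoprime_add_mul h1 0
    · exact isCoprime_add_mul h2 3
    · refine le_of_mul_le_mul_left (a := x 0 0) (le_of_eq ?_) hm
      unfold quadForm
      linear_combination mk + x₁ 0 0 ^ 2 * d
        + (x 0 0 * x₁ 0 1 - x₁ 0 0 * x 0 1 + x₂ 0 0 - 3 * x 0 0 * x₁ 0 0) * c1
    · refine le_of_mul_le_mul_left (a := x 0 0) (le_of_eq ?_) hm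
      unfold quadForm
      linear_combination mk + x₂ 0 0 ^ 2 * d
        - (x 0 0 * x₂ 0 1 + 3 * x 0 0 * x₂ 0 0 - x₂ 0 0 * x 0 1 - x₁ 0 0) * c2
    · refine le_of_mul_le_mul_left (a := x 0 0) (le_of_eq ?_) hm
      unfold polarForm
      linear_combination 3 * x 0 0 * mk + 2 * x₁ 0 0 * x₂ 0 0 * d
        + 2 * (x 0 0 * x₂ 0 1 + 3 * x 0 0 * x₂ 0 0 - x₂ 0 0 * x 0 1) * c1 - 2 * x₂ 0 0 * c2
        - 3 * x 0 0 * (x₂ 0 0 * c1 - x₁ 0 0 * c2)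
  have := E.le_quadForm (v := (U, T)) hm.le (by simp; omega) (by simp [cross]; linarith)
    (by simp [cross]; linarith)
  simp only [markoffForm, quadForm] at this ⊢
  linarith

end IsMarkoffNode

theorem BinTree.isMarkoffNode (v : BinTree) :
    IsMarkoffNode v.matrices.1 v.matrices.2.1 v.matrices.2.2 := by
  induction v with
  | base =>
    have h53 : IsCoprime (5 : ℤ) 2 := ⟨1, -2, by norm_num⟩
    constructor <;>
      simp [BinTree.matrices, Matrix.IsSymm, ← Matrix.ext_iff, Fin.forall_fin_two, M,
        Matrix.det_fin_two, h53, isCoprime_one_right]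
  | left v ih => exact ih.left
  | right v ih => exact ih.right

/-! ### The matrices along a zigzag -/

/-- A sequence of matrices, any three consecutive ones of which form a Markoff triple with the last
as its first component; `ε i` tells in which order `x (i + 1)` and `x i` come, and it alternates. -/
structure IsMarkoffChain (ε : ℕ → ℤ) (x : ℕ → Matrix (Fin 2) (Fin 2) ℤ) : Prop where
  sign : ∀ i, ε i = 1 ∨ ε i = -1
  alternate : ∀ i, ε (i + 1) = -ε i
  lt : ∀ i, x i 0 0 < x (i + 1) 0 0
  node_left : ∀ i, ε i = 1 → IsMarkoffNode (x (i + 2)) (x (i + 1)) (x i)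
  node_right : ∀ i, ε i = -1 → IsMarkoffNode (x (i + 2)) (x i) (x (i + 1))

theorem IsSucc.corner_lt {d : Side} {v w : Vertex} (h : IsSucc d v w) :
    v.matrix 0 0 < w.matrix 0 0 := by
  cases h with
  | root => simp [Vertex.matrix, BinTree.matrices]
  | left v => exact v.isMarkoffNode.left.lt₂
  | right v => exact v.isMarkoffNode.right.lt₁

theorem IsSucc.isMarkoffNode_left {u v w : Vertex} (h : IsSucc .left u v)
    (h' : IsSucc .right v w) : IsMarkoffNode w.matrix v.matrix u.matrix := by
  cases h with
  | root => cases h'; exact (BinTree.right .base).isMarkoffNode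
  | left v => cases h'; exact v.left.right.isMarkoffNode

theorem IsSucc.isMarkoffNode_right {u v w : Vertex} (h : IsSucc .right u v)
    (h' : IsSucc .left v w) : IsMarkoffNode w.matrix u.matrix v.matrix := by
  cases h with
  | right v => cases h'; exact v.right.left.isMarkoffNode

/-- The sign `1` for the left side and `-1` for the right side. -/
def Side.sign : Side → ℤ
  | .left => 1
  | .right => -1

theorem IsZigzag.exists_isMarkoffChain {s : ℕ → Vertex} (hs : IsZigzag s) :
    ∃ ε, IsMarkoffChain ε (fun i => (s i).matrix) := by
  choose d hd hd' using hs
  have hsucc : ∀ i, d (i + 1) = (d i).other := fun i => (hd (i + 1)).side_unique (hd' i)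
  refine ⟨fun i => (d i).sign, ⟨fun i => ?_, fun i => ?_, fun i => (hd i).corner_lt,
    fun i h => ?_, fun i h => ?_⟩⟩
  · cases d i <;> simp [Side.sign]
  · show (d (i + 1)).sign = -(d i).sign
    rw [hsucc]
    cases d i <;> rfl
  · have e : d i = .left := by
      cases hdi : d i
      · rfl
      · simp [hdi, Side.sign] at h
    have h1 := hd i
    have h2 := hd' i
    rw [e] at h1 h2
    exact h1.isMarkoffNode_left h2
  · have e : d i = .right := by
      cases hdi : d i
      · simp [hdi, Side.sign] at h
      · rfl
    have h1 := hd i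
    have h2 := hd' i
    rw [e] at h1 h2
    exact h1.isMarkoffNode_right h2

namespace IsMarkoffChain

variable {ε : ℕ → ℤ} {x : ℕ → Matrix (Fin 2) (Fin 2) ℤ}

theorem exists_node (h : IsMarkoffChain ε x) (i : ℕ) :
    ∃ x₁ x₂, IsMarkoffNode (x (i + 2)) x₁ x₂ ∧ (x i = x₁ ∨ x i = x₂) := by
  rcases h.sign i with hi | hi
  · exact ⟨_, _, h.node_left i hi, .inr rfl⟩
  · exact ⟨_, _, h.node_right i hi, .inl rfl⟩

theorem isSymm (h : IsMarkoffChain ε x) (i : ℕ) : (x i).IsSymm := by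
  obtain ⟨x₁, x₂, n, e | e⟩ := h.exists_node i
  · exact e ▸ n.symm₁
  · exact e ▸ n.symm₂

theorem det_eq_one (h : IsMarkoffChain ε x) (i : ℕ) : (x i).det = 1 := by
  obtain ⟨x₁, x₂, n, e | e⟩ := h.exists_node i
  · exact e ▸ n.det₁
  · exact e ▸ n.det₂

theorem one_le (h : IsMarkoffChain ε x) (i : ℕ) : 1 ≤ x i 0 0 := by
  obtain ⟨x₁, x₂, n, e | e⟩ := h.exists_node i
  · exact e ▸ n.one_le₁
  · exact e ▸ n.one_le₂

theorem entries_det (h : IsMarkoffChain ε x) (i : ℕ) : x i 0 0 * x i 1 1 - x i 0 1 ^ 2 = 1 := by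
  have := h.det_eq_one i
  rw [Matrix.det_fin_two, (h.isSymm i).apply 0 1] at this
  linear_combination this

theorem markoff (h : IsMarkoffChain ε x) (i : ℕ) :
    x (i + 2) 0 0 ^ 2 + x (i + 1) 0 0 ^ 2 + x i 0 0 ^ 2
      = 3 * x (i + 2) 0 0 * x (i + 1) 0 0 * x i 0 0 := by
  rcases h.sign i with hi | hi
  · exact (h.node_left i hi).markoff
  · linear_combination (h.node_right i hi).markoff

theorem two_mul_le (h : IsMarkoffChain ε x) (i : ℕ) :
    2 * x (i + 1) 0 0 * x i 0 0 ≤ x (i + 2) 0 0 := by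
  rcases h.sign i with hi | hi
  · exact (h.node_left i hi).two_mul_le
  · linarith [(h.node_right i hi).two_mul_le]

/-- The sign of `k_{i+1}/m_{i+1} - k_{i+2}/m_{i+2}` is `ε i`; the slopes thus oscillate. -/
theorem cross (h : IsMarkoffChain ε x) (i : ℕ) :
    x (i + 2) 0 0 * x (i + 1) 0 1 - x (i + 1) 0 0 * x (i + 2) 0 1 = ε i * x i 0 0 := by
  rcases h.sign i with hi | hi
  · rw [hi]
    linear_combination (h.node_left i hi).cross₁
  · rw [hi]
    linear_combination -(h.node_right i hi).cross₂

theorem add_one_le (h : IsMarkoffChain ε x) (i : ℕ) : (i : ℤ) + 1 ≤ x i 0 0 := by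
  induction i with
  | zero => simpa using h.one_le 0
  | succ i ih => have := h.lt i; push_cast; omega

end IsMarkoffChain

/-! ### The limit of the slopes -/

/-- The quotient `k / m` for the symmetric matrix `x i` with entries `m, k, l`. -/
noncomputable def slope (x : ℕ → Matrix (Fin 2) (Fin 2) ℤ) (i : ℕ) : ℝ :=
  (x i 0 1 : ℝ) / x i 0 0

namespace IsMarkoffChain

variable {ε : ℕ → ℤ} {x : ℕ → Matrix (Fin 2) (Fin 2) ℤ} {ξ : ℝ}

theorem one_le_real (h : IsMarkoffChain ε x) (i : ℕ) : (1 : ℝ) ≤ x i 0 0 := by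
  exact_mod_cast h.one_le i

theorem pos_real (h : IsMarkoffChain ε x) (i : ℕ) : (0 : ℝ) < x i 0 0 :=
  one_pos.trans_le (h.one_le_real i)

theorem strictMono (h : IsMarkoffChain ε x) : StrictMono fun i => x i 0 0 :=
  strictMono_nat_of_lt_succ h.lt

theorem tendsto_corner (h : IsMarkoffChain ε x) :
    Tendsto (fun i => (x i 0 0 : ℝ)) atTop atTop := by
  refine tendsto_atTop_mono (fun i => ?_) tendsto_natCast_atTop_atTop
  have := h.add_one_le i
  have : ((i : ℤ) : ℝ) ≤ x i 0 0 := by exact_mod_cast (by omega)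
  simpa using this

theorem two_mul_le_real (h : IsMarkoffChain ε x) (i : ℕ) :
    2 * (x (i + 1) 0 0 : ℝ) * x i 0 0 ≤ x (i + 2) 0 0 := by
  exact_mod_cast h.two_mul_le i

theorem sign_sq (h : IsMarkoffChain ε x) (i : ℕ) : (ε i : ℝ) * ε i = 1 := by
  rcases h.sign i with e | e <;> simp [e]

theorem abs_sign (h : IsMarkoffChain ε x) (i : ℕ) : |(ε i : ℝ)| = 1 := by
  rcases h.sign i with e | e <;> simp [e]

theorem slope_sub_slope (h : IsMarkoffChain ε x) (i : ℕ) :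
    slope x (i + 1) - slope x (i + 2)
      = ε i * (x i 0 0 / (x (i + 1) 0 0 * x (i + 2) 0 0)) := by
  have h1 := h.pos_real (i + 1)
  have h2 := h.pos_real (i + 2)
  have hc : (x (i + 2) 0 0 : ℝ) * x (i + 1) 0 1 - x (i + 1) 0 0 * x (i + 2) 0 1
      = ε i * x i 0 0 := by exact_mod_cast h.cross i
  unfold slope
  field_simp
  linear_combination hc

theorem abs_slope_sub_slope_le (h : IsMarkoffChain ε x) (i : ℕ) :
    |slope x (i + 1) - slope x (i + 2)| ≤ 1 / (2 * (x (i + 1) 0 0 : ℝ) ^ 2) := by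
  have h0 := h.pos_real i
  have h1 := h.pos_real (i + 1)
  have h2 := h.pos_real (i + 2)
  rw [h.slope_sub_slope, abs_mul, h.abs_sign, one_mul, abs_of_pos (by positivity),
    div_le_div_iff₀ (by positivity) (by positivity)]
  have := mul_le_mul_of_nonneg_left (h.two_mul_le_real i) h1.le
  linarith

theorem two_pow_mul_le (h : IsMarkoffChain ε x) (i n : ℕ) :
    2 ^ n * (x (i + 1) 0 0 : ℝ) ≤ x (i + 1 + n) 0 0 := by
  induction n with
  | zero => simp
  | succ n ih =>
    have h1 := h.two_mul_le_real (i + n)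
    have h2 := h.one_le_real (i + n)
    have h3 := h.pos_real (i + n + 1)
    rw [show i + 1 + n = i + n + 1 by omega] at ih
    rw [show i + 1 + (n + 1) = i + n + 2 by omega, pow_succ]
    nlinarith

theorem dist_slope_le (h : IsMarkoffChain ε x) (i n : ℕ) :
    dist (slope x (i + 1 + n)) (slope x (i + 1 + (n + 1)))
      ≤ 1 / (x (i + 1) 0 0 : ℝ) ^ 2 / 2 / 2 ^ n := by
  have h1 := h.abs_slope_sub_slope_le (i + n)
  rw [show i + n + 1 = i + 1 + n by omega, show i + n + 2 = i + 1 + (n + 1) by omega] at h1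
  rw [Real.dist_eq]
  refine h1.trans ?_
  have h2 := h.two_pow_mul_le i n
  have h3 := h.pos_real (i + 1)
  have h4 := h.pos_real (i + 1 + n)
  rw [div_div, div_div]
  refine one_div_le_one_div_of_le (by positivity) ?_
  have h5 : (1 : ℝ) ≤ 2 ^ n := one_le_pow₀ (by norm_num)
  have h6 : (2 ^ n * (x (i + 1) 0 0 : ℝ)) ^ 2 ≤ (x (i + 1 + n) 0 0 : ℝ) ^ 2 := by gcongr
  have h7 : (2 : ℝ) ^ n * (x (i + 1) 0 0 : ℝ) ^ 2 ≤ (2 ^ n * (x (i + 1) 0 0 : ℝ)) ^ 2 := by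
    rw [mul_pow]
    gcongr
    nlinarith
  linarith

theorem exists_tendsto_slope (h : IsMarkoffChain ε x) : ∃ ξ, Tendsto (slope x) atTop (𝓝 ξ) := by
  have : CauchySeq fun n => slope x (n + 1) :=
    cauchySeq_of_le_geometric_two (C := 1 / (x (0 + 1) 0 0 : ℝ) ^ 2) fun n => by
      have := h.dist_slope_le 0 n
      rwa [show 0 + 1 + n = n + 1 by omega, show 0 + 1 + (n + 1) = n + 1 + 1 by omega] at this
  obtain ⟨ξ, hξ⟩ := cauchySeq_tendsto_of_complete this
  exact ⟨ξ, (tendsto_add_atTop_iff_nat 1).1 hξ⟩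

theorem abs_slope_sub_le (h : IsMarkoffChain ε x) (hξ : Tendsto (slope x) atTop (𝓝 ξ)) (i : ℕ) :
    |slope x (i + 1) - ξ| ≤ 1 / (x (i + 1) 0 0 : ℝ) ^ 2 := by
  have h1 : Tendsto (fun n => slope x (i + 1 + n)) atTop (𝓝 ξ) := by
    simpa only [add_comm] using (tendsto_add_atTop_iff_nat (i + 1)).2 hξ
  exact dist_le_of_le_geometric_two_of_tendsto₀ (h.dist_slope_le i) h1

/-- The first gap after `x (i + 1)`, scaled by `m_{i+1}²`, is `m_i m_{i+1} / m_{i+2}`, which is near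
`1/3` by the Markoff equation; the later gaps are negligible. -/
theorem abs_sign_mul_sub_third_le (h : IsMarkoffChain ε x)
    (hξ : Tendsto (slope x) atTop (𝓝 ξ)) (i : ℕ) :
    |ε i * ((x (i + 1) 0 0 : ℝ) ^ 2 * (slope x (i + 1) - ξ)) - 1 / 3|
      ≤ 1 / (x i 0 0 : ℝ) ^ 2 := by
  have hw := h.abs_slope_sub_le hξ (i + 1)
  have hu := h.slope_sub_slope i
  have hm : (x (i + 2) 0 0 : ℝ) ^ 2 + (x (i + 1) 0 0 : ℝ) ^ 2 + (x i 0 0 : ℝ) ^ 2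
      = 3 * x (i + 2) 0 0 * x (i + 1) 0 0 * x i 0 0 := by exact_mod_cast h.markoff i
  have h2 := h.two_mul_le_real i
  have p0 := h.pos_real i
  have p1 := h.pos_real (i + 1)
  have p2 := h.pos_real (i + 2)
  have l1 : (x i 0 0 : ℝ) < x (i + 1) 0 0 := by exact_mod_cast h.lt i
  have es := h.sign_sq i
  have ea := h.abs_sign i
  rw [show i + 1 + 1 = i + 2 from rfl] at hw
  set a := (x i 0 0 : ℝ)
  set b := (x (i + 1) 0 0 : ℝ)
  set c := (x (i + 2) 0 0 : ℝ)
  set w := slope x (i + 2) - ξ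
  have hsq : 4 * b ^ 2 * a ^ 2 ≤ c ^ 2 := by
    have : (2 * b * a) ^ 2 ≤ c ^ 2 := by gcongr
    nlinarith
  have key : ε i * (b ^ 2 * (slope x (i + 1) - ξ)) - 1 / 3
      = (a ^ 2 + b ^ 2) / (3 * c ^ 2) + ε i * (b ^ 2 * w) := by
    have e1 : slope x (i + 1) - ξ = ε i * (a / (b * c)) + w := by
      rw [← hu]; ring
    have e2 : (ε i : ℝ) * (b ^ 2 * (ε i * (a / (b * c)) + w))
        = (ε i * ε i) * (b ^ 2 * (a / (b * c))) + ε i * (b ^ 2 * w) := by ring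
    rw [e1, e2, es]
    field_simp
    linear_combination -hm
  have b1 : |(ε i : ℝ) * (b ^ 2 * w)| ≤ 1 / (4 * a ^ 2) := by
    rw [abs_mul, ea, one_mul, abs_mul, abs_of_pos (by positivity : 0 < b ^ 2)]
    calc b ^ 2 * |w| ≤ b ^ 2 * (1 / c ^ 2) := by gcongr
      _ ≤ 1 / (4 * a ^ 2) := by
        rw [mul_one_div, div_le_div_iff₀ (by positivity) (by positivity)]
        linarith
  have b2 : |(a ^ 2 + b ^ 2) / (3 * c ^ 2)| ≤ 1 / (4 * a ^ 2) := by
    rw [abs_of_pos (by positivity), div_le_div_iff₀ (by positivity) (by positivity)]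
    have : a ^ 2 * a ^ 2 ≤ b ^ 2 * a ^ 2 := by gcongr
    nlinarith
  rw [key]
  refine (abs_add_le _ _).trans ((add_le_add b2 b1).trans ?_)
  rw [← add_div, div_le_div_iff₀ (by positivity) (by positivity)]
  nlinarith [sq_nonneg a]

theorem tendsto_inv_corner_sq (h : IsMarkoffChain ε x) :
    Tendsto (fun i => 1 / (x i 0 0 : ℝ) ^ 2) atTop (𝓝 0) := by
  simp_rw [one_div]
  exact (tendsto_pow_atTop two_ne_zero |>.comp h.tendsto_corner).inv_tendsto_atTop

theorem tendsto_sign_mul (h : IsMarkoffChain ε x) (hξ : Tendsto (slope x) atTop (𝓝 ξ)) :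
    Tendsto (fun i => ε i * ((x (i + 1) 0 0 : ℝ) ^ 2 * (slope x (i + 1) - ξ))) atTop
      (𝓝 (1 / 3)) := by
  rw [tendsto_iff_dist_tendsto_zero]
  exact squeeze_zero (fun _ => dist_nonneg) (h.abs_sign_mul_sub_third_le hξ)
    h.tendsto_inv_corner_sq

theorem corner_mul_abs (h : IsMarkoffChain ε x) (ξ : ℝ) (i : ℕ) :
    x i 0 0 * |ξ * x i 0 0 - x i 0 1| = |(x i 0 0 : ℝ) ^ 2 * (slope x i - ξ)| := by
  have p := h.pos_real i
  have e : (x i 0 0 : ℝ) ^ 2 * (slope x i - ξ) = x i 0 0 * -(ξ * x i 0 0 - x i 0 1) := by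
    unfold slope
    field_simp
    ring
  rw [e, abs_mul, abs_neg, abs_of_pos p]

/-- The convergents `k / m` approximate the limit `ξ` with error asymptotic to `1 / (3 m²)`. -/
theorem tendsto_corner_mul_abs (h : IsMarkoffChain ε x) (hξ : Tendsto (slope x) atTop (𝓝 ξ)) :
    Tendsto (fun i => x i 0 0 * |ξ * x i 0 0 - x i 0 1|) atTop (𝓝 (1 / 3)) := by
  refine (tendsto_add_atTop_iff_nat 1).1 ?_
  have := (h.tendsto_sign_mul hξ).abs
  rw [abs_of_pos (by norm_num : (0 : ℝ) < 1 / 3)] at this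
  refine this.congr fun i => ?_
  rw [h.corner_mul_abs, abs_mul, h.abs_sign, one_mul]

theorem eventually_between (h : IsMarkoffChain ε x) (hξ : Tendsto (slope x) atTop (𝓝 ξ)) :
    ∀ᶠ i in atTop, (1 : ℝ) / 6 < x i 0 0 * |ξ * x i 0 0 - x i 0 1| ∧
      x i 0 0 * |ξ * x i 0 0 - x i 0 1| < 1 :=
  (h.tendsto_corner_mul_abs hξ).eventually
    (Ioo_mem_nhds (by norm_num) (by norm_num))

/-- If `ξ` were rational with denominator `d`, then `d |ξ m - k|` would be a non-zero
integer smaller than `1` for large `i`. -/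
theorem irrational (h : IsMarkoffChain ε x) (hξ : Tendsto (slope x) atTop (𝓝 ξ)) :
    Irrational ξ := by
  rintro ⟨r, rfl⟩
  have hd : (0 : ℝ) < r.den := by exact_mod_cast r.den_pos
  obtain ⟨i, ⟨h1, h2⟩, h3⟩ := ((h.eventually_between hξ).and
    (h.tendsto_corner.eventually_ge_atTop (r.den : ℝ))).exists
  have p := h.pos_real i
  have e : (r.den : ℝ) * |(r : ℝ) * x i 0 0 - x i 0 1|
      = |((r.num * x i 0 0 - r.den * x i 0 1 : ℤ) : ℝ)| := by
    have e' := abs_mul (r.den : ℝ) ((r : ℝ) * x i 0 0 - x i 0 1)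
    rw [abs_of_pos hd] at e'
    rw [← e']
    congr 1
    push_cast
    have : (r : ℝ) * r.den = r.num := by exact_mod_cast Rat.mul_den_eq_num r
    linear_combination (x i 0 0 : ℝ) * this
  have hlt : (r.den : ℝ) * |(r : ℝ) * x i 0 0 - x i 0 1| < 1 :=
    (mul_le_mul_of_nonneg_right h3 (abs_nonneg _)).trans_lt h2
  have hz : r.num * x i 0 0 - r.den * x i 0 1 = 0 := by
    rw [e, ← Int.cast_abs] at hlt
    exact Int.abs_lt_one_iff.1 (by exact_mod_cast hlt)
  rw [hz] at e
  have : |(r : ℝ) * x i 0 0 - x i 0 1| = 0 := by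
    simpa [hd.ne'] using e
  rw [this] at h1
  norm_num at h1

/-- If `a ξ² + b ξ + c = 0`, then the integer `a l + b k + c m` vanishes for large `i`, so that
`m² (a (k/m)² + b (k/m) + c) = -a`; as `k/m - ξ` changes sign at each step, this forces `a = 0`. -/
theorem not_quadratic (h : IsMarkoffChain ε x) (hξ : Tendsto (slope x) atTop (𝓝 ξ))
    (a b c : ℤ) (ha : a ≠ 0) : (a : ℝ) * ξ ^ 2 + b * ξ + c ≠ 0 := by
  intro h0
  set m : ℕ → ℝ := fun i => x i 0 0
  have hval : ∀ i, m i * (a * x i 1 1 + b * x i 0 1 + c * x i 0 0)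
      = a + (m i ^ 2 * (slope x i - ξ)) * (a * (slope x i + ξ) + b) := by
    intro i
    have p : m i ≠ 0 := (h.pos_real i).ne'
    have d : (x i 0 0 : ℝ) * x i 1 1 - (x i 0 1 : ℝ) ^ 2 = 1 := by exact_mod_cast h.entries_det i
    have e : (x i 0 1 : ℝ) = m i * slope x i := by
      unfold slope
      rw [mul_div_cancel₀ _ p]
    change m i * _ - _ = _ at d
    rw [e] at d ⊢
    show m i * (a * x i 1 1 + b * (m i * slope x i) + c * m i) = _
    linear_combination a * d + m i ^ 2 * h0
  have hlin : Tendsto (fun i => (a : ℝ) * (slope x i + ξ) + b) atTop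
      (𝓝 (a * (ξ + ξ) + b)) := ((hξ.add_const ξ).const_mul _).add_const _
  have hprod := (h.tendsto_sign_mul hξ).mul ((tendsto_add_atTop_iff_nat 1).2 hlin)
  -- the integers `a l + b k + c m` vanish for large `i`
  have hbdd : Tendsto (fun i => ((a : ℝ) * x i 1 1 + b * x i 0 1 + c * x i 0 0)) atTop (𝓝 0) := by
    refine (tendsto_add_atTop_iff_nat 1).1 ?_
    have hs : Tendsto (fun i => (ε i : ℝ) * (m (i + 1) * (a * x (i + 1) 1 1 + b * x (i + 1) 0 1
        + c * x (i + 1) 0 0)) - ε i * a) atTop (𝓝 (1 / 3 * (a * (ξ + ξ) + b))) := by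
      refine hprod.congr fun i => ?_
      rw [hval]
      ring
    have hb := hs.abs.bddAbove_range
    obtain ⟨B, hB⟩ := hb
    have hinv : Tendsto (fun i => (B + |(a : ℝ)|) * (m (i + 1))⁻¹) atTop (𝓝 0) := by
      simpa using ((tendsto_add_atTop_iff_nat 1).2 h.tendsto_corner).inv_tendsto_atTop.const_mul
        (B + |(a : ℝ)|)
    refine squeeze_zero_norm (fun i => ?_) hinv
    have hp : 0 < m (i + 1) := h.pos_real (i + 1)
    have hBi := hB ⟨i, rfl⟩
    dsimp only at hBi
    rw [← mul_sub, abs_mul, h.abs_sign, one_mul] at hBi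
    have habs := abs_mul (m (i + 1)) (a * x (i + 1) 1 1 + b * x (i + 1) 0 1 + c * x (i + 1) 0 0)
    rw [abs_of_pos hp] at habs
    rw [Real.norm_eq_abs, ← div_eq_mul_inv, le_div_iff₀ hp, mul_comm, ← habs]
    have := abs_sub_abs_le_abs_sub (m (i + 1) * (a * x (i + 1) 1 1 + b * x (i + 1) 0 1
        + c * x (i + 1) 0 0)) (a : ℝ)
    linarith
  have hzero : ∀ᶠ i in atTop, (a : ℝ) * x i 1 1 + b * x i 0 1 + c * x i 0 0 = 0 := by
    filter_upwards [(tendsto_zero_iff_abs_tendsto_zero _ |>.1 hbdd).eventually_lt_const one_pos]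
      with i hi
    dsimp only [Function.comp_apply] at hi
    have hi' : |a * x i 1 1 + b * x i 0 1 + c * x i 0 0| < 1 := by exact_mod_cast hi
    exact_mod_cast Int.abs_lt_one_iff.1 hi'
  have hconst : Tendsto (fun i => -((ε i : ℝ) * a)) atTop (𝓝 (1 / 3 * (a * (ξ + ξ) + b))) := by
    refine hprod.congr' ?_
    filter_upwards [(tendsto_add_atTop_nat 1).eventually hzero] with i hi
    have := hval (i + 1)
    rw [hi, mul_zero] at this
    linear_combination -(ε i : ℝ) * this
  -- the sign alternates, so the limit equals its opposite
  have hneg : Tendsto (fun i => -((ε i : ℝ) * a)) atTop (𝓝 (-(1 / 3 * (a * (ξ + ξ) + b)))) := by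
    refine (((tendsto_add_atTop_iff_nat 1).2 hconst).neg).congr fun i => ?_
    rw [h.alternate]
    push_cast
    ring
  have hL := tendsto_nhds_unique hconst hneg
  have habs := hconst.abs
  rw [show 1 / 3 * (a * (ξ + ξ) + b) = 0 by linarith, abs_zero] at habs
  have : (fun i => |-((ε i : ℝ) * a)|) = fun _ => |(a : ℝ)| := by
    funext i
    rw [abs_neg, abs_mul, h.abs_sign, one_mul]
  rw [this] at habs
  have := tendsto_nhds_unique habs tendsto_const_nhds
  exact ha (by exact_mod_cast (abs_eq_zero.1 this.symm))

end IsMarkoffChain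

/-! ### Comparable sequences and the growth of the matrices -/

theorem Comparable.symm {f g : ℕ → ℝ} (h : Comparable f g) : Comparable g f := by
  obtain ⟨c, C, hc, hC, H⟩ := h
  refine ⟨C⁻¹, c⁻¹, by positivity, by positivity, fun i => ⟨?_, ?_⟩⟩
  · rw [inv_mul_le_iff₀ hC]; exact (H i).2
  · rw [le_inv_mul_iff₀ hc]; exact (H i).1

theorem Comparable.trans {f g k : ℕ → ℝ} (h : Comparable f g) (h' : Comparable g k) :
    Comparable f k := by
  obtain ⟨c, C, hc, hC, H⟩ := h
  obtain ⟨c', C', hc', hC', H'⟩ := h'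
  refine ⟨c * c', C * C', by positivity, by positivity, fun i => ⟨?_, ?_⟩⟩
  · rw [mul_assoc]
    exact (mul_le_mul_of_nonneg_left (H' i).1 hc.le).trans (H i).1
  · rw [mul_assoc]
    exact (H i).2.trans (mul_le_mul_of_nonneg_left (H' i).2 hC.le)

theorem Comparable.rpow {f g : ℕ → ℝ} (h : Comparable f g) (hf : ∀ i, 0 ≤ f i) (hg : ∀ i, 0 ≤ g i)
    {r : ℝ} (hr : 0 ≤ r) : Comparable (fun i => f i ^ r) (fun i => g i ^ r) := by
  obtain ⟨c, C, hc, hC, H⟩ := h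
  refine ⟨c ^ r, C ^ r, by positivity, by positivity, fun i => ⟨?_, ?_⟩⟩
  · rw [← Real.mul_rpow hc.le (hg i)]
    exact Real.rpow_le_rpow (mul_nonneg hc.le (hg i)) (H i).1 hr
  · rw [← Real.mul_rpow hC.le (hg i)]
    exact Real.rpow_le_rpow (hf i) (H i).2 hr

theorem Comparable.inv {f g : ℕ → ℝ} (h : Comparable f g) (hf : ∀ i, 0 < f i) (hg : ∀ i, 0 < g i) :
    Comparable (fun i => (f i)⁻¹) (fun i => (g i)⁻¹) := by
  obtain ⟨c, C, hc, hC, H⟩ := h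
  refine ⟨C⁻¹, c⁻¹, by positivity, by positivity, fun i => ⟨?_, ?_⟩⟩
  · rw [← mul_inv]
    exact inv_anti₀ (hf i) (H i).2
  · rw [← mul_inv]
    exact inv_anti₀ (mul_pos hc (hg i)) (H i).1

theorem Comparable.comp_succ {f g : ℕ → ℝ} (h : Comparable f g) :
    Comparable (fun i => f (i + 1)) (fun i => g (i + 1)) := by
  obtain ⟨c, C, hc, hC, H⟩ := h
  exact ⟨c, C, hc, hC, fun i => H (i + 1)⟩

theorem comparable_one_of_tendsto {f : ℕ → ℝ} {L : ℝ} (hf : ∀ i, 0 < f i) (hL : 0 < L)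
    (h : Tendsto f atTop (𝓝 L)) : Comparable f fun _ => 1 := by
  obtain ⟨B, hB⟩ := h.bddAbove_range
  obtain ⟨B', hB'⟩ := (h.inv₀ hL.ne').bddAbove_range
  have h1 : ∀ i, f i ≤ B := fun i => hB ⟨i, rfl⟩
  have h2 : ∀ i, (f i)⁻¹ ≤ B' := fun i => hB' ⟨i, rfl⟩
  have hB0 : 0 < B := (hf 0).trans_le (h1 0)
  have hB0' : 0 < B' := (inv_pos.2 (hf 0)).trans_le (h2 0)
  refine ⟨B'⁻¹, B, inv_pos.2 hB0', hB0, fun i => ⟨?_, ?_⟩⟩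
  · rw [mul_one]
    exact inv_le_of_inv_le₀ (hf i) (h2 i)
  · rw [mul_one]
    exact h1 i

theorem le_matNorm (A : Matrix (Fin 2) (Fin 2) ℤ) : (A 0 0 : ℝ) ≤ matNorm A :=
  (le_abs_self _).trans ((le_max_left _ _).trans (le_max_left _ _))

namespace IsMarkoffChain

variable {ε : ℕ → ℤ} {x : ℕ → Matrix (Fin 2) (Fin 2) ℤ} {ξ : ℝ}

theorem comparable_error (h : IsMarkoffChain ε x) (hξ : Tendsto (slope x) atTop (𝓝 ξ)) :
    Comparable (fun i => |ξ * x i 0 0 - x i 0 1|) (fun i => (x i 0 0 : ℝ)⁻¹) := by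
  have hpos : ∀ i, 0 < x i 0 0 * |ξ * x i 0 0 - x i 0 1| := by
    intro i
    refine mul_pos (h.pos_real i) (abs_pos.2 fun h0 => ?_)
    refine (h.irrational hξ).ne_rat ((x i 0 1 : ℚ) / x i 0 0) ?_
    push_cast
    rw [eq_div_iff (h.pos_real i).ne']
    linarith
  obtain ⟨c, C, hc, hC, H⟩ :=
    comparable_one_of_tendsto hpos (by norm_num) (h.tendsto_corner_mul_abs hξ)
  refine ⟨c, C, hc, hC, fun i => ⟨?_, ?_⟩⟩
  · rw [← div_eq_mul_inv, div_le_iff₀' (h.pos_real i)]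
    simpa using (H i).1
  · rw [← div_eq_mul_inv, le_div_iff₀' (h.pos_real i)]
    simpa using (H i).2

theorem exists_abs_le (h : IsMarkoffChain ε x) (hξ : Tendsto (slope x) atTop (𝓝 ξ)) :
    ∃ B : ℝ, 0 ≤ B ∧ ∀ i, |(x i 0 1 : ℝ)| ≤ B * x i 0 0 := by
  obtain ⟨B, hB⟩ := hξ.abs.bddAbove_range
  have h1 : ∀ i, |slope x i| ≤ B := fun i => hB ⟨i, rfl⟩
  refine ⟨B, (abs_nonneg _).trans (h1 0), fun i => ?_⟩
  have := h1 i
  rwa [slope, abs_div, abs_of_pos (h.pos_real i), div_le_iff₀ (h.pos_real i)] at this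

theorem entries_det_real (h : IsMarkoffChain ε x) (i : ℕ) :
    (x i 0 0 : ℝ) * x i 1 1 - (x i 0 1 : ℝ) ^ 2 = 1 := by
  exact_mod_cast h.entries_det i

theorem comparable_matNorm (h : IsMarkoffChain ε x) (hξ : Tendsto (slope x) atTop (𝓝 ξ)) :
    Comparable (fun i => matNorm (x i)) (fun i => (x i 0 0 : ℝ)) := by
  obtain ⟨B, hB0, hB⟩ := h.exists_abs_le hξ
  refine ⟨1, 1 + B + B ^ 2, one_pos, by positivity, fun i => ⟨?_, ?_⟩⟩
  · rw [one_mul]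
    exact (le_abs_self _).trans ((le_max_left _ _).trans (le_max_left _ _))
  · have p := h.pos_real i
    have p1 := h.one_le_real i
    have hk := hB i
    have d := h.entries_det_real i
    have hl : |(x i 1 1 : ℝ)| ≤ (1 + B ^ 2) * x i 0 0 := by
      have e : (x i 0 0 : ℝ) * |(x i 1 1 : ℝ)| = 1 + (x i 0 1 : ℝ) ^ 2 := by
        have e' := abs_mul (x i 0 0 : ℝ) (x i 1 1 : ℝ)
        rw [abs_of_pos p] at e'
        rw [← e', show (x i 0 0 : ℝ) * x i 1 1 = 1 + (x i 0 1 : ℝ) ^ 2 by linarith]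
        exact abs_of_nonneg (by positivity)
      refine le_of_mul_le_mul_left (a := (x i 0 0 : ℝ)) ?_ p
      rw [e, ← sq_abs (x i 0 1 : ℝ)]
      have : |(x i 0 1 : ℝ)| ^ 2 ≤ (B * x i 0 0) ^ 2 := by gcongr
      nlinarith
    have b1 : 0 ≤ B * x i 0 0 := by positivity
    have b2 : 0 ≤ B ^ 2 * x i 0 0 := by positivity
    show max (max |(x i 0 0 : ℝ)| |(x i 0 1 : ℝ)|) (max |(x i 1 0 : ℝ)| |(x i 1 1 : ℝ)|) ≤ _
    rw [(h.isSymm i).apply 0 1, abs_of_pos p]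
    refine max_le (max_le ?_ ?_) (max_le ?_ ?_) <;> linarith

theorem comparable_rowNorm (h : IsMarkoffChain ε x) (hξ : Tendsto (slope x) atTop (𝓝 ξ)) :
    Comparable (fun i => rowNorm ξ (x i)) (fun i => (x i 0 0 : ℝ)⁻¹) := by
  obtain ⟨B, hB0, hB⟩ := h.exists_abs_le hξ
  obtain ⟨c, C, hc, hC, H⟩ := h.comparable_error hξ
  refine ⟨c, C + (B * C + 1), hc, by positivity, fun i => ⟨?_, ?_⟩⟩
  · refine (H i).1.trans ?_
    show |ξ * (x i 0 0 : ℝ) - x i 0 1| ≤ rowNorm ξ (x i)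
    rw [← (h.isSymm i).apply 0 1]
    exact le_max_left _ _
  · have p := h.pos_real i
    have h1 : |ξ * (x i 0 0 : ℝ) - x i 0 1| ≤ C * (x i 0 0 : ℝ)⁻¹ := (H i).2
    have d := h.entries_det_real i
    have h2 : |ξ * x i 0 1 - x i 1 1| ≤ (B * C + 1) * (x i 0 0 : ℝ)⁻¹ := by
      rw [← div_eq_mul_inv, le_div_iff₀' p]
      have e := abs_mul (x i 0 0 : ℝ) (ξ * x i 0 1 - x i 1 1)
      rw [abs_of_pos p] at e
      rw [← e, show (x i 0 0 : ℝ) * (ξ * x i 0 1 - x i 1 1)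
        = x i 0 1 * (ξ * x i 0 0 - x i 0 1) - 1 by linear_combination -d]
      refine (abs_sub _ _).trans ?_
      rw [abs_mul, abs_one]
      have : |(x i 0 1 : ℝ)| * |ξ * x i 0 0 - x i 0 1|
          ≤ (B * x i 0 0) * (C * (x i 0 0 : ℝ)⁻¹) := by
        refine mul_le_mul (hB i) h1 (abs_nonneg _) (by positivity)
      rw [show (B * x i 0 0) * (C * (x i 0 0 : ℝ)⁻¹)
        = B * C * (x i 0 0 * (x i 0 0 : ℝ)⁻¹) by ring, mul_inv_cancel₀ p.ne'] at this
      linarith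
    have b1 : 0 ≤ C * (x i 0 0 : ℝ)⁻¹ := by positivity
    have b2 : 0 ≤ (B * C + 1) * (x i 0 0 : ℝ)⁻¹ := by positivity
    show max |ξ * (x i 0 0 : ℝ) - x i 1 0| |ξ * (x i 0 1 : ℝ) - x i 1 1| ≤ _ * (x i 0 0 : ℝ)⁻¹
    rw [(h.isSymm i).apply 0 1, add_mul]
    exact max_le (by linarith) (by linarith)

theorem abs_log_sub_le (h : IsMarkoffChain ε x) (i : ℕ) :
    |Real.log (x (i + 2) 0 0) - Real.log (x (i + 1) 0 0) - Real.log (x i 0 0)| ≤ 2 := by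
  have p0 := h.pos_real i
  have p1 := h.pos_real (i + 1)
  have p2 := h.pos_real (i + 2)
  have lo := h.two_mul_le_real i
  have hm : (x (i + 2) 0 0 : ℝ) ^ 2 + (x (i + 1) 0 0 : ℝ) ^ 2 + (x i 0 0 : ℝ) ^ 2
      = 3 * x (i + 2) 0 0 * x (i + 1) 0 0 * x i 0 0 := by exact_mod_cast h.markoff i
  have hi : (x (i + 2) 0 0 : ℝ) ≤ 3 * (x (i + 1) 0 0 * x i 0 0) := by
    refine le_of_mul_le_mul_left (a := (x (i + 2) 0 0 : ℝ)) ?_ p2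
    nlinarith [sq_nonneg (x (i + 1) 0 0 : ℝ), sq_nonneg (x i 0 0 : ℝ)]
  have pp : (0 : ℝ) < x (i + 1) 0 0 * x i 0 0 := mul_pos p1 p0
  have h1 : Real.log (x (i + 1) 0 0 * x i 0 0) ≤ Real.log (x (i + 2) 0 0) :=
    Real.log_le_log pp (by linarith)
  have h2 := Real.log_le_log p2 hi
  rw [Real.log_mul (by norm_num) pp.ne'] at h2
  rw [Real.log_mul p1.ne' p0.ne'] at h1 h2
  have h3 : Real.log 3 ≤ 2 := by
    have := Real.log_le_sub_one_of_pos (by norm_num : (0 : ℝ) < 3)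
    linarith
  rw [abs_le]
  constructor <;> linarith

/-- As `m_{i+2}` is comparable to `m_{i+1} m_i`, the quantity `log m_{i+1} - γ log m_i` is
multiplied at each step by `-1/γ`, up to a bounded error. -/
theorem exists_abs_log_sub_le (h : IsMarkoffChain ε x) :
    ∃ K, ∀ i, |Real.log (x (i + 1) 0 0) - Real.goldenRatio * Real.log (x i 0 0)| ≤ K := by
  set γ := Real.goldenRatio
  have hγ : γ ^ 2 = γ + 1 := Real.goldenRatio_sq
  have hγ1 : 1 < γ := Real.one_lt_goldenRatio
  have hγ2 : γ < 2 := Real.goldenRatio_lt_two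
  set y : ℕ → ℝ := fun i => Real.log (x (i + 1) 0 0) - γ * Real.log (x i 0 0) with hy
  refine ⟨|y 0| + 2 * γ ^ 2, fun i => ?_⟩
  show |y i| ≤ _
  induction i with
  | zero => have := sq_nonneg γ; linarith
  | succ i ih =>
    have e : y (i + 1) = (Real.log (x (i + 2) 0 0) - Real.log (x (i + 1) 0 0)
        - Real.log (x i 0 0)) + -((γ - 1) * y i) := by
      simp only [hy, show i + 1 + 1 = i + 2 from rfl]
      linear_combination -Real.log (x i 0 0) * hγ
    rw [e]
    refine (abs_add_le _ _).trans ?_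
    rw [abs_neg, abs_mul, abs_of_pos (by linarith : 0 < γ - 1)]
    have h1 := h.abs_log_sub_le i
    have h2 := mul_le_mul_of_nonneg_left ih (by linarith : 0 ≤ γ - 1)
    have h3 : (γ - 1) * (2 * γ ^ 2) + 2 = 2 * γ ^ 2 := by
      linear_combination 2 * (γ - 1) * hγ
    have h4 : (γ - 1) * |y 0| ≤ |y 0| := by nlinarith [abs_nonneg (y 0)]
    linarith

/-- The growth `m_{i+1} ≍ m_i ^ γ`. -/
theorem comparable_corner_succ (h : IsMarkoffChain ε x) :
    Comparable (fun i => (x (i + 1) 0 0 : ℝ)) (fun i => (x i 0 0 : ℝ) ^ Real.goldenRatio) := by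
  obtain ⟨K, hK⟩ := h.exists_abs_log_sub_le
  refine ⟨Real.exp (-K), Real.exp K, Real.exp_pos _, Real.exp_pos _, fun i => ?_⟩
  have hi := abs_le.1 (hK i)
  have e := Real.exp_log (h.pos_real (i + 1))
  show _ * (x i 0 0 : ℝ) ^ Real.goldenRatio ≤ (x (i + 1) 0 0 : ℝ) ∧
    (x (i + 1) 0 0 : ℝ) ≤ _ * (x i 0 0 : ℝ) ^ Real.goldenRatio
  rw [Real.rpow_def_of_pos (h.pos_real i), ← Real.exp_add, ← Real.exp_add, ← e]
  constructor <;> refine Real.exp_le_exp.2 ?_ <;> linarith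

theorem corresponds (h : IsMarkoffChain ε x) (hξ : Tendsto (slope x) atTop (𝓝 ξ)) :
    Corresponds ξ x where
  symm := h.isSymm
  primitive i d hd := by
    have := h.entries_det i
    refine isUnit_of_dvd_one ?_
    rw [← this, pow_two]
    exact dvd_sub ((hd 0 0).mul_right _) ((hd 0 1).mul_right _)
  unbounded B := by
    obtain ⟨i, hi⟩ := (h.tendsto_corner.eventually_gt_atTop B).exists
    exact ⟨i, hi.trans_le (le_matNorm _)⟩
  growth := by
    have hn := h.comparable_matNorm hξ
    have hg : 0 ≤ Real.goldenRatio := Real.goldenRatio_pos.le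
    exact hn.comp_succ.trans (h.comparable_corner_succ.trans
      ((hn.rpow (fun i => (h.pos_real i).le.trans (le_matNorm _)) (fun i => (h.pos_real i).le)
        hg).symm))
  approx := (h.comparable_rowNorm hξ).trans ((h.comparable_matNorm hξ).inv
    (fun i => (h.pos_real i).trans_le (le_matNorm _)) h.pos_real).symm
  det := ⟨1, 1, one_pos, one_pos, fun i => by simp [h.det_eq_one]⟩

/-- The sequence determines the number to which it corresponds. -/
theorem tendsto_slope_of_corresponds (h : IsMarkoffChain ε x) (hc : Corresponds ξ x) :
    Tendsto (slope x) atTop (𝓝 ξ) := by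
  obtain ⟨c, C, _, hC, H⟩ := hc.approx
  rw [tendsto_iff_norm_sub_tendsto_zero]
  have hlim : Tendsto (fun i => C * (x i 0 0 : ℝ)⁻¹) atTop (𝓝 0) := by
    simpa using h.tendsto_corner.inv_tendsto_atTop.const_mul C
  refine squeeze_zero (fun _ => norm_nonneg _) (fun i => ?_) hlim
  have p := h.pos_real i
  have h1 : |ξ * x i 0 0 - x i 0 1| ≤ C * (x i 0 0 : ℝ)⁻¹ := by
    rw [← (h.isSymm i).apply 0 1]
    refine (le_max_left _ _).trans ((H i).2.trans ?_)
    have := inv_anti₀ p (le_matNorm (x i))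
    gcongr
  have e : slope x i - ξ = -((ξ * x i 0 0 - x i 0 1) / x i 0 0) := by
    unfold slope
    field_simp
    ring
  rw [Real.norm_eq_abs, e, abs_neg, abs_div, abs_of_pos p]
  exact (div_le_self (abs_nonneg _) (h.one_le_real i)).trans h1

/-- For `m_i ≤ X < m_{i+1}` the entries of `x i` solve the system, because
`1 / m_i ≍ m_{i+1} ^ (-1/γ)`; for `X < m_0` the point `(0, 1, 0)` does. -/
theorem isExtremal (h : IsMarkoffChain ε x) (hξ : Tendsto (slope x) atTop (𝓝 ξ)) :
    IsExtremal ξ := by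
  refine ⟨h.irrational hξ, h.not_quadratic hξ, ?_⟩
  have hg : 0 < Real.goldenRatio := Real.goldenRatio_pos
  obtain ⟨c₁, C₁, hc₁, hC₁, H₁⟩ := h.comparable_corner_succ
  obtain ⟨c₂, C₂, hc₂, hC₂, H₂⟩ := h.comparable_rowNorm hξ
  obtain ⟨B, hB0, hB⟩ := h.exists_abs_le hξ
  set r := 1 / Real.goldenRatio with hr
  have hr0 : 0 < r := by positivity
  have hneg : -1 / Real.goldenRatio = -r := by rw [hr]; ring
  rw [hneg]
  -- `1 / m_i` is bounded by a multiple of `X ^ (-1/γ)` as long as `X ≤ m_{i+1}`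
  have key : ∀ i (X : ℝ), 1 ≤ X → X ≤ x (i + 1) 0 0 →
      (x i 0 0 : ℝ)⁻¹ ≤ C₁ ^ r * X ^ (-r) := by
    intro i X hX hXi
    have p := h.pos_real i
    have hX0 : 0 < X := by linarith
    have h1 : X ^ r ≤ C₁ ^ r * x i 0 0 := by
      calc X ^ r ≤ (C₁ * (x i 0 0 : ℝ) ^ Real.goldenRatio) ^ r :=
            Real.rpow_le_rpow hX0.le (hXi.trans (H₁ i).2) hr0.le
        _ = C₁ ^ r * x i 0 0 := by
          rw [Real.mul_rpow hC₁.le (by positivity), ← Real.rpow_mul p.le, hr,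
            mul_one_div_cancel hg.ne', Real.rpow_one]
    rw [Real.rpow_neg hX0.le, ← div_eq_mul_inv, le_div_iff₀ (by positivity), inv_mul_le_iff₀ p]
    linarith
  set D := C₂ * (1 + |ξ|) with hD
  have hD0 : 0 < D := by positivity
  refine ⟨D * C₁ ^ r + (x 0 0 0 : ℝ) ^ r, by have := h.pos_real 0; positivity,
    fun X hX => ?_⟩
  have hX0 : 0 < X := by linarith
  have hp0 := h.pos_real 0
  have hex : ∃ j, X < x j 0 0 := (h.tendsto_corner.eventually_gt_atTop X).exists
  have hj := Nat.find_spec hex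
  have hmin : ∀ n < Nat.find hex, ¬ X < x n 0 0 := fun n hn => Nat.find_min hex hn
  generalize Nat.find hex = j at hj hmin
  cases j with
  | zero =>
    refine ⟨0, 1, 0, by simp, by simpa using hX0.le, ?_, ?_⟩
    · have : 1 ≤ (x 0 0 0 : ℝ) ^ r * X ^ (-r) := by
        rw [Real.rpow_neg hX0.le, ← div_eq_mul_inv, one_le_div (by positivity)]
        exact Real.rpow_le_rpow hX0.le hj.le hr0.le
      have h2 : 0 ≤ D * C₁ ^ r * X ^ (-r) := by positivity
      rw [add_mul]
      simpa using (by linarith : (1 : ℝ) ≤ D * C₁ ^ r * X ^ (-r) + (x 0 0 0 : ℝ) ^ r * X ^ (-r))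
    · simp only [Int.cast_zero, zero_mul, sub_zero, abs_zero]
      positivity
  | succ i =>
    have p := h.pos_real i
    have hle : (x i 0 0 : ℝ) ≤ X := not_lt.1 (hmin i (Nat.lt_succ_self i))
    have hk := key i X hX hj.le
    have hrow := (H₂ i).2
    have hn1 : |ξ * x i 0 0 - x i 0 1| ≤ C₂ * (x i 0 0 : ℝ)⁻¹ := by
      rw [← (h.isSymm i).apply 0 1]
      exact (le_max_left _ _).trans hrow
    have hn2 : |ξ * x i 0 1 - x i 1 1| ≤ C₂ * (x i 0 0 : ℝ)⁻¹ := (le_max_right _ _).trans hrow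
    have hfin : D * (x i 0 0 : ℝ)⁻¹ ≤ (D * C₁ ^ r + (x 0 0 0 : ℝ) ^ r) * X ^ (-r) := by
      have h1 := mul_le_mul_of_nonneg_left hk hD0.le
      have h2 : 0 ≤ (x 0 0 0 : ℝ) ^ r * X ^ (-r) := by positivity
      linarith
    have hpos : 0 ≤ C₂ * (x i 0 0 : ℝ)⁻¹ := by positivity
    have hDe : D * (x i 0 0 : ℝ)⁻¹
        = C₂ * (x i 0 0 : ℝ)⁻¹ + |ξ| * (C₂ * (x i 0 0 : ℝ)⁻¹) := by
      rw [hD]; ring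
    have hxi := mul_le_mul_of_nonneg_left hn1 (abs_nonneg ξ)
    have hxi0 := mul_nonneg (abs_nonneg ξ) hpos
    refine ⟨x i 0 0, x i 0 1, x i 1 1, ?_, ?_, ?_, ?_⟩
    · intro h0
      have : x i 0 0 = 0 := congrArg Prod.fst h0
      have := h.one_le i
      omega
    · rwa [abs_of_pos p]
    · rw [mul_comm]
      linarith
    · have e : (x i 0 0 : ℝ) * ξ ^ 2 - x i 1 1
          = ξ * (ξ * x i 0 0 - x i 0 1) + (ξ * x i 0 1 - x i 1 1) := by ring
      rw [e]
      refine (abs_add_le _ _).trans ?_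
      rw [abs_mul]
      linarith

end IsMarkoffChain

/-! ### The minimum of the limit form and the Lagrange constant -/

namespace IsMarkoffChain

variable {ε : ℕ → ℤ} {x : ℕ → Matrix (Fin 2) (Fin 2) ℤ} {ξ : ℝ}

theorem tendsto_markoffForm (h : IsMarkoffChain ε x) (hξ : Tendsto (slope x) atTop (𝓝 ξ))
    (U T : ℤ) :
    Tendsto (fun i => (markoffForm (x i) (U, T) : ℝ) / x i 0 0) atTop (𝓝 (G ξ U T)) := by
  have h1 : Tendsto (fun i => ((1 / (x i 0 0 : ℝ) ^ 2 + slope x i ^ 2) + 3 * slope x i)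
      * (U : ℝ) ^ 2 - (2 * slope x i + 3) * (U * T) + (T : ℝ) ^ 2) atTop
      (𝓝 (((0 + ξ ^ 2) + 3 * ξ) * (U : ℝ) ^ 2 - (2 * ξ + 3) * (U * T) + (T : ℝ) ^ 2)) :=
    ((((h.tendsto_inv_corner_sq.add (hξ.pow 2)).add (hξ.const_mul 3)).mul_const _).sub
      (((hξ.const_mul 2).add_const 3).mul_const _)).add_const _
  have e : G ξ U T
      = ((0 + ξ ^ 2) + 3 * ξ) * (U : ℝ) ^ 2 - (2 * ξ + 3) * (U * T) + (T : ℝ) ^ 2 := by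
    unfold G; ring
  rw [e]
  refine h1.congr fun i => ?_
  have p := h.pos_real i
  have d := h.entries_det_real i
  have hl : (x i 1 1 : ℝ) = (1 + (x i 0 1 : ℝ) ^ 2) / x i 0 0 := by
    rw [eq_div_iff p.ne']
    linarith
  simp only [markoffForm, quadForm, slope]
  push_cast
  rw [hl]
  field_simp
  ring

theorem mul_le_mul_of_lt_slope (h : IsMarkoffChain ε x) {U T : ℤ} (hU : 0 < U) {i : ℕ}
    (hi : (T : ℝ) / U < slope x i) : x i 0 0 * T ≤ x i 0 1 * U := by
  have hU' : (0 : ℝ) < U := by exact_mod_cast hU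
  rw [slope, div_lt_div_iff₀ hU' (h.pos_real i)] at hi
  have : T * x i 0 0 < x i 0 1 * U := by exact_mod_cast hi
  linarith

theorem mul_le_mul_of_slope_lt (h : IsMarkoffChain ε x) {U T : ℤ} (hU : 0 < U) {i : ℕ}
    (hi : slope x i < (T : ℝ) / U) : x i 0 1 * U ≤ x i 0 0 * T := by
  have hU' : (0 : ℝ) < U := by exact_mod_cast hU
  rw [slope, div_lt_div_iff₀ (h.pos_real i) hU'] at hi
  have : x i 0 1 * U < T * x i 0 0 := by exact_mod_cast hi
  linarith

/-- For `(U, T)` fixed, the three cones controlled by the Markoff form of `x i` contain `(U, T)` or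
`(-U, -T)` as soon as `i` is large, since their boundaries tend to the lines of slope `ξ`
and `ξ + 3`. -/
theorem eventually_corner_le (h : IsMarkoffChain ε x) (hξ : Tendsto (slope x) atTop (𝓝 ξ))
    {U T : ℤ} (hU : 0 < U) :
    ∀ᶠ i in atTop, x (i + 2) 0 0 ≤ |markoffForm (x (i + 2)) (U, T)| := by
  have hU' : (0 : ℝ) < U := by exact_mod_cast hU
  have hirr := h.irrational hξ
  have shift : (((T - 3 * U : ℤ) : ℝ)) / U = (T : ℝ) / U - 3 := by
    push_cast
    field_simp
  have node : ∀ i, ∃ x₁ x₂, IsMarkoffNode (x (i + 2)) x₁ x₂ := fun i => by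
    obtain ⟨x₁, x₂, n, -⟩ := h.exists_node i
    exact ⟨x₁, x₂, n⟩
  rcases lt_or_ge ((T : ℝ) / U) ξ with h1 | h1
  · filter_upwards [((tendsto_add_atTop_iff_nat 2).2 hξ).eventually_const_lt h1] with i hi
    obtain ⟨x₁, x₂, n⟩ := node i
    exact (n.le_of_slope_le hU (h.mul_le_mul_of_lt_slope hU hi)).trans (le_abs_self _)
  have h1 : ξ < (T : ℝ) / U := lt_of_le_of_ne h1 (by
    have := hirr.ne_rat ((T : ℚ) / U)
    push_cast at this
    exact this)
  rcases lt_or_ge ξ (((T - 3 * U : ℤ) : ℝ) / U) with h2 | h2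
  · filter_upwards [((tendsto_add_atTop_iff_nat 2).2 hξ).eventually_lt_const h2] with i hi
    obtain ⟨x₁, x₂, n⟩ := node i
    have := h.mul_le_mul_of_slope_lt hU hi
    exact (n.le_of_le_slope hU (by linarith)).trans (le_abs_self _)
  have h2 : ((T - 3 * U : ℤ) : ℝ) / U < ξ := lt_of_le_of_ne h2 (by
    have := hirr.ne_rat (((T - 3 * U : ℤ) : ℚ) / U)
    push_cast at this ⊢
    exact this.symm)
  have e1 : ∀ᶠ i in atTop, x i 0 1 * U ≤ x i 0 0 * T ∧
      x i 0 0 * T ≤ (x i 0 1 + 3 * x i 0 0) * U := by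
    filter_upwards [hξ.eventually_lt_const h1, hξ.eventually_const_lt h2] with i hi hi'
    have := h.mul_le_mul_of_lt_slope hU hi'
    exact ⟨h.mul_le_mul_of_slope_lt hU hi, by linarith⟩
  filter_upwards [e1, (tendsto_add_atTop_nat 1).eventually e1] with i hi hi'
  refine le_trans ?_ (neg_le_abs _)
  rcases h.sign i with hs | hs
  · exact (h.node_left i hs).le_neg_of_slope_between hU hi'.1 hi.2
  · exact (h.node_right i hs).le_neg_of_slope_between hU hi.1 hi'.2

theorem one_le_abs_G_of_pos (h : IsMarkoffChain ε x) (hξ : Tendsto (slope x) atTop (𝓝 ξ))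
    {U T : ℤ} (hU : 0 < U) : 1 ≤ |G ξ U T| := by
  have hlim := ((tendsto_add_atTop_iff_nat 2).2 (h.tendsto_markoffForm hξ U T)).abs
  refine ge_of_tendsto hlim ?_
  filter_upwards [h.eventually_corner_le (T := T) hξ hU] with i hi
  have p := h.pos_real (i + 2)
  rw [abs_div, abs_of_pos p, one_le_div p]
  exact_mod_cast hi

/-- The minimum `m` of the Markoff forms passes to the limit `G`. -/
theorem one_le_abs_G (h : IsMarkoffChain ε x) (hξ : Tendsto (slope x) atTop (𝓝 ξ))
    {U T : ℤ} (hUT : (U, T) ≠ (0, 0)) : 1 ≤ |G ξ U T| := by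
  rcases lt_trichotomy U 0 with hU | rfl | hU
  · have := h.one_le_abs_G_of_pos (T := -T) hξ (neg_pos.2 hU)
    have e : G ξ ((-U : ℤ) : ℝ) ((-T : ℤ) : ℝ) = G ξ U T := by
      unfold G; push_cast; ring
    rwa [e] at this
  · have hT : T ≠ 0 := fun hT => hUT (by rw [hT])
    have e : |G ξ ((0 : ℤ) : ℝ) T| = ((T ^ 2 : ℤ) : ℝ) := by
      have : G ξ ((0 : ℤ) : ℝ) T = (T : ℝ) ^ 2 := by unfold G; push_cast; ring
      rw [this, abs_of_nonneg (sq_nonneg _)]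
      push_cast
      rfl
    rw [e]
    have : 1 ≤ T ^ 2 := by have := sq_pos_of_ne_zero hT; omega
    exact_mod_cast this
  · exact h.one_le_abs_G_of_pos hξ hU

theorem formMin_eq_one (h : IsMarkoffChain ε x) (hξ : Tendsto (slope x) atTop (𝓝 ξ)) :
    formMin (G ξ) = 1 := by
  refine le_antisymm (csInf_le ⟨0, ?_⟩ ⟨0, 1, by simp, by simp [G]⟩)
    (le_csInf ⟨_, 0, 1, by simp, rfl⟩ ?_)
  · rintro r ⟨U, T, -, rfl⟩
    exact abs_nonneg _
  · rintro r ⟨U, T, hUT, rfl⟩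
    exact h.one_le_abs_G hξ hUT

theorem third_le_of_infinite (h : IsMarkoffChain ε x) (hξ : Tendsto (slope x) atTop (𝓝 ξ))
    {c : ℝ} (hc : 0 < c)
    (hinf : {pq : ℤ × ℤ | 1 ≤ pq.2 ∧ |ξ - (pq.1 : ℝ) / (pq.2 : ℝ)| ≤ c / (pq.2 : ℝ) ^ 2}.Infinite) :
    1 / 3 ≤ c := by
  by_contra! hlt
  refine hinf ?_
  -- the denominators are bounded, because `1 ≤ |G (q, p)| ≤ 3 c + (c / q)²`
  obtain ⟨Q, hQ⟩ : ∃ Q : ℕ, c ^ 2 < (1 - 3 * c) * Q := by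
    obtain ⟨Q, hQ⟩ := exists_nat_gt (c ^ 2 / (1 - 3 * c))
    refine ⟨Q, ?_⟩
    rwa [div_lt_iff₀' (by linarith)] at hQ
  obtain ⟨P, hP⟩ := exists_nat_gt ((|ξ| + c) * Q)
  refine ((Set.finite_Icc (-(P : ℤ)) P).prod (Set.finite_Icc (1 : ℤ) Q)).subset ?_
  rintro ⟨p, q⟩ ⟨hq, hpq⟩
  dsimp only at hq hpq
  have hq1 : (1 : ℝ) ≤ q := by exact_mod_cast hq
  have hq0 : (0 : ℝ) < q := by linarith
  have herr : |(p : ℝ) - ξ * q| ≤ c / q := by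
    have e : (p : ℝ) - ξ * q = -(ξ - p / q) * q := by field_simp; ring
    rw [e, abs_mul, abs_neg, abs_of_pos hq0, le_div_iff₀ hq0]
    rw [le_div_iff₀ (by positivity)] at hpq
    linarith
  have hqQ : q ≤ Q := by
    by_contra! hqQ
    have hqQ' : (Q : ℝ) < q := by exact_mod_cast hqQ
    have hG := h.one_le_abs_G (U := q) (T := p) hξ (fun h0 => by
      have : q = 0 := congrArg Prod.fst h0
      omega)
    have hG' : |G ξ q p| ≤ c / q * (c / q + 3 * q) := by
      unfold G
      rw [abs_mul]
      refine mul_le_mul herr ?_ (abs_nonneg _) (by positivity)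
      rw [show (p : ℝ) - (ξ + 3) * q = (p - ξ * q) - 3 * q by ring]
      refine (abs_sub _ _).trans ?_
      rw [abs_of_pos (by positivity : (0 : ℝ) < 3 * q)]
      linarith
    have e : c / q * (c / q + 3 * q) = (c / q) ^ 2 + 3 * c := by field_simp
    have h3 : c ^ 2 < (1 - 3 * c) * (q : ℝ) ^ 2 := by
      have : (Q : ℝ) ≤ (q : ℝ) ^ 2 := by nlinarith
      have := mul_le_mul_of_nonneg_left this (by linarith : 0 ≤ 1 - 3 * c)
      linarith
    have h4 : (c / q) ^ 2 < 1 - 3 * c := by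
      rw [div_pow, div_lt_iff₀ (by positivity)]
      exact h3
    linarith
  have hqQ' : (q : ℝ) ≤ Q := by exact_mod_cast hqQ
  have hp : |(p : ℝ)| ≤ P := by
    have h1 : |(p : ℝ)| ≤ |(p : ℝ) - ξ * q| + |ξ * q| := by
      simpa using abs_add_le ((p : ℝ) - ξ * q) (ξ * q)
    rw [abs_mul, abs_of_pos hq0] at h1
    have h2 : c / q ≤ c * q := (div_le_self hc.le hq1).trans (le_mul_of_one_le_right hc.le hq1)
    have h3 : (|ξ| + c) * q ≤ (|ξ| + c) * Q := by gcongr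
    linarith
  have hp' : |p| ≤ P := by exact_mod_cast hp
  exact ⟨abs_le.1 hp', hq, hqQ⟩

/-- The fractions `k_i / m_i` are solutions. -/
theorem infinite_of_third_lt (h : IsMarkoffChain ε x) (hξ : Tendsto (slope x) atTop (𝓝 ξ))
    {c : ℝ} (hc : 1 / 3 < c) :
    {pq : ℤ × ℤ | 1 ≤ pq.2 ∧
      |ξ - (pq.1 : ℝ) / (pq.2 : ℝ)| ≤ c / (pq.2 : ℝ) ^ 2}.Infinite := by
  obtain ⟨N, hN⟩ := eventually_atTop.1
    ((h.tendsto_corner_mul_abs hξ).eventually_lt_const hc)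
  refine Set.infinite_of_injective_forall_mem (f := fun n => (x (N + n) 0 1, x (N + n) 0 0))
    (fun a b hab => ?_) fun n => ⟨h.one_le _, ?_⟩
  · have := h.strictMono.injective (congrArg Prod.snd hab : x (N + a) 0 0 = x (N + b) 0 0)
    omega
  · have p := h.pos_real (N + n)
    have hlt := hN (N + n) (by omega)
    rw [h.corner_mul_abs, abs_mul, abs_of_pos (by positivity), abs_sub_comm] at hlt
    rw [le_div_iff₀ (by positivity), mul_comm]
    exact hlt.le

theorem lagrangeConstant_eq (h : IsMarkoffChain ε x) (hξ : Tendsto (slope x) atTop (𝓝 ξ)) :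
    lagrangeConstant ξ = 1 / 3 := by
  have hmem : ∀ c : ℝ, 1 / 3 < c → c ∈ {c : ℝ | 0 < c ∧
      {pq : ℤ × ℤ | 1 ≤ pq.2 ∧ |ξ - (pq.1 : ℝ) / (pq.2 : ℝ)| ≤ c / (pq.2 : ℝ) ^ 2}.Infinite} :=
    fun c hc => ⟨by linarith, h.infinite_of_third_lt hξ hc⟩
  refine le_antisymm (le_of_forall_gt_imp_ge_of_dense fun c hc => csInf_le ⟨0, ?_⟩ (hmem c hc))
    (le_csInf ⟨1, hmem 1 (by norm_num)⟩ ?_)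
  · rintro r ⟨hr, -⟩
    exact hr.le
  · rintro c ⟨hc, hinf⟩
    exact h.third_le_of_infinite hξ hc hinf

end IsMarkoffChain

theorem IsXi.exists_isMarkoffChain {m : ℤ × ℤ × ℤ} {ξ : ℝ} (h : IsXi m ξ) :
    ∃ (s : ℕ → Vertex) (ε : ℕ → ℤ), IsMaximalZigzag s ∧ (s 0).triple = m ∧
      IsMarkoffChain ε (fun i => (s i).matrix) ∧
      Tendsto (slope fun i => (s i).matrix) atTop (𝓝 ξ) := by
  obtain ⟨-, s, hs, hs0, hc⟩ := h
  obtain ⟨ε, hε⟩ := hs.1.exists_isMarkoffChain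
  exact ⟨s, ε, hs, hs0, hε, hε.tendsto_slope_of_corresponds hc⟩

end MarkoffExtremal

theorem corollary5p9 (m : ℤ × ℤ × ℤ) (hm : m ∈ MarkoffExtremal.SigmaStar) :
    (∃! ξ : ℝ, MarkoffExtremal.IsXi m ξ) ∧
    ∀ ξ : ℝ, MarkoffExtremal.IsXi m ξ →
      MarkoffExtremal.lagrangeConstant ξ
          = MarkoffExtremal.formMin (MarkoffExtremal.G ξ) / 3 ∧
      MarkoffExtremal.formMin (MarkoffExtremal.G ξ) / 3 = 1 / 3 := by
  refine ⟨?_, fun ξ hξ => ?_⟩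
  · obtain ⟨v, rfl⟩ := hm
    obtain ⟨s, ⟨hs, hs0⟩, huniq⟩ := MarkoffExtremal.existsUnique_maximalZigzag v
    obtain ⟨ε, hε⟩ := hs.1.exists_isMarkoffChain
    obtain ⟨ξ, hξ⟩ := hε.exists_tendsto_slope
    refine ⟨ξ, ⟨hε.isExtremal hξ, s, hs, by rw [hs0], hε.corresponds hξ⟩, fun ξ' hξ' => ?_⟩
    obtain ⟨s', ε', hs', hs0', -, hlim⟩ := hξ'.exists_isMarkoffChain
    rw [huniq s' ⟨hs', MarkoffExtremal.Vertex.triple_injective hs0'⟩] at hlim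
    exact tendsto_nhds_unique hlim hξ
  · obtain ⟨s, ε, -, -, hε, hlim⟩ := hξ.exists_isMarkoffChain
    rw [hε.formMin_eq_one hlim, hε.lagrangeConstant_eq hlim]
    exact ⟨rfl, rfl⟩
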